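/- Let $d\ge 1$ and $\eta<1$. There is a constant $C_0>0$, depending only on $d$ and $\eta$, such that the following holds for all integers $h,m\ge 1$. Let $\mathbb{N}_h=\{-h,\dots,h\}^d\setminus\{0\}$, and let $\Phi_h$ be the set of vectors $\phi\in\mathbb{R}^{\mathbb{N}_h}$ with $\phi_i=\phi_{-i}$ for which there is an invertible covariance operator $\Gamma=\Gamma(\phi)$ on $\ell^2(\mathbb{Z}^d)$, necessarily unique, of a stationary Gaussian Markov random field on $\mathbb{Z}^d$ with unit variance such that, for all $i,j\in\mathbb{Z}^d$, $\Gamma^{-1}_{i,j}/\Gamma^{-1}_{i,i}$ equals $1$ if $i=j$, equals $-\phi_{i-j}$ if $1\le|i-j|_\infty\le h$, and equals $0$ otherwise. Let $\mathcal{V}=\{1,\dots,m\}^d$. For $S\subset\mathcal{V}$ let $\Gamma_S(\phi)=(\Gamma_{i,j}(\phi))_{i,j\in S}$, and let $S^h$ be the set of points of $S$ whose $\ell_\infty$-distance to $\mathbb{Z}^d\setminus S$ exceeds $h$. Let $\mathbb{P}_0$ be the standard normal distribution on $\mathbb{R}^{\mathcal{V}}$, and let $\mathbb{P}_{S,\phi}$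 be the law of a centered Gaussian vector $X=(X_i)_{i\in\mathcal{V}}$ such that $X_S=(X_i)_{i\in S}$ has covariance matrix $\Gamma_S(\phi)$ and the $X_i$, $i\notin S$, are standard normal, independent of each other and of $X_S$. Let $\mathcal{C}$ be a nonempty class of subsets of $\mathcal{V}$ with $|S^h|\ge|S|/2$ for every $S\in\mathcal{C}$, and let $\phi\in\Phi_h$ satisfy $\|\phi\|_1\le\eta$. For $x\in\mathbb{R}^{\mathcal{V}}$ put \[ U(x)=\max_{S\in\mathcal{C}}\ \frac{x_S^\top(\mathbf{I}_S-\Gamma_S^{-1}(\phi))x_S-\operatorname{Tr}(\mathbf{I}_S-\Gamma_S^{-1}(\phi))}{\|\mathbf{I}_S-\Gamma_S^{-1}(\phi)\|_F\sqrt{\log|\mathcal{C}|}+\|\mathbf{I}_S-\Gamma_S^{-1}(\phi)\|\log|\mathcal{C}|}, \] where $\|\cdot\|_F$ is the Frobenius norm, $\|\cdot\|$ is the $\ell^2\to\ell^2$ operator norm, and a fraction with denominator $0$ is read as $0$ (under the condition below this happens only if $|\mathcal{C}|=1$). If \[ \|\phi\|_2^2\ \min_{S\in\mathcal{C}}|S|\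 \ge\ C_0\log|\mathcal{C}|, \] then $f(x)=\mathbf{1}\{U(x)>4\}$ is measurable, and its risk satisfies \[ \mathbb{P}_0\{f(X)=1\}+\max_{S\in\mathcal{C}}\mathbb{P}_{S,\phi}\{f(X)=0\}\ \le\ \frac{2}{|\mathcal{C}|}. \] -/

import Mathlib

open MeasureTheory ProbabilityTheory

noncomputable section

namespace HiddenGMRF

/-- The infinite lattice `ℤ^d`. Its distance is the one of the sup norm. -/
abbrev Lattice (d : ℕ) : Type := Fin d → ℤ

/-- The neighborhood `ℕ_h = {-h, …, h}^d \ {0}`. -/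
def nbhd (d h : ℕ) : Finset (Lattice d) :=
  (Finset.Icc (fun _ => -(h : ℤ)) (fun _ => (h : ℤ))).erase 0

/-- `‖φ‖₁`. -/
def l1Norm {d h : ℕ} (φ : nbhd d h → ℝ) : ℝ := ∑ i, |φ i|

/-- `‖φ‖₂`. -/
def l2Norm {d h : ℕ} (φ : nbhd d h → ℝ) : ℝ := Real.sqrt (∑ i, φ i ^ 2)

/-- The Hilbert space `ℓ²(ℤ^d)`. -/
abbrev L2 (d : ℕ) : Type := lp (fun _ : Lattice d => ℝ) 2

/-- The entry `A_{i,j}` of a bounded operator on `ℓ²(ℤ^d)`. -/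
def entry {d : ℕ} (A : L2 d →L[ℝ] L2 d) (i j : Lattice d) : ℝ :=
  A (lp.single 2 j (1 : ℝ)) i

/-- `Γ` is the covariance operator of a stationary Gaussian Markov random field on `ℤ^d` with unit
variance, neighborhood `ℕ_h` and parameter `φ`: it is nonsingular, and the normalized entries
`Γ⁻¹_{i,j} / Γ⁻¹_{i,i}` of its inverse are `1` if `i = j`, `-φ_{i-j}` if `1 ≤ |i-j|_∞ ≤ h`, and
`0` otherwise. -/
structure IsGMRFCovariance {d h : ℕ} (φ : nbhd d h → ℝ) (Γ : L2 d →L[ℝ] L2 d) : Prop where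
  isPositive : Γ.IsPositive
  stationary : ∀ i j v, entry Γ (i + v) (j + v) = entry Γ i j
  unit_variance : ∀ i, entry Γ i i = 1
  nonsingular : IsUnit Γ
  inverse_entry : ∀ i j, entry (Ring.inverse Γ) i j / entry (Ring.inverse Γ) i i =
    if i = j then 1
    else if hv : i - j ∈ nbhd d h then -φ ⟨i - j, hv⟩ else 0

/-- The parameter set `Φ_h`: the vectors `φ` with `φ_i = φ_{-i}` that are the parameter of the
nonsingular covariance operator of a stationary Gaussian Markov random field with unit variance
and neighborhood `ℕ_h`. -/
def paramSet (d h : ℕ) : Set (nbhd d h → ℝ) :=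
  {φ | (∀ i j : nbhd d h, (j : Lattice d) = -(i : Lattice d) → φ j = φ i) ∧
    ∃ Γ : L2 d →L[ℝ] L2 d, IsGMRFCovariance φ Γ}

open Classical in
/-- The covariance operator `Γ(φ)`, for `φ ∈ Φ_h` (and `0` otherwise). Uniqueness, and existence
for `‖φ‖₁ < 1`, are shown below. -/
def Gam {d h : ℕ} (φ : nbhd d h → ℝ) : L2 d →L[ℝ] L2 d :=
  if H : ∃ Γ : L2 d →L[ℝ] L2 d, IsGMRFCovariance φ Γ then H.choose else 0

theorem isGMRFCovariance_Gam {d h : ℕ} {φ : nbhd d h → ℝ} (hφ : φ ∈ paramSet d h) :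
    IsGMRFCovariance φ (Gam φ) := by
  unfold Gam
  rw [dif_pos hφ.2]
  exact hφ.2.choose_spec

section WellDefined

open scoped InnerProductSpace

variable {d h : ℕ}

/-- Translation by `v` on `ℓ²(ℤ^d)`. -/
def shiftFun (v : Lattice d) (f : L2 d) : L2 d :=
  ⟨fun i => f (i - v), by
    have hf := lp.memℓp f
    rw [memℓp_gen_iff (by norm_num)] at hf
    exact memℓp_gen ((Equiv.subRight v).summable_iff.mpr hf)⟩

theorem norm_shiftFun (v : Lattice d) (f : L2 d) : ‖shiftFun v f‖ = ‖f‖ := by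
  rw [lp.norm_eq_tsum_rpow (by norm_num), lp.norm_eq_tsum_rpow (by norm_num)]
  congr 1
  exact (Equiv.subRight v).tsum_eq (fun i => ‖f i‖ ^ (2 : ENNReal).toReal)

/-- Translation by `v` as a bounded operator. -/
def shift (v : Lattice d) : L2 d →L[ℝ] L2 d :=
  LinearMap.mkContinuous
    { toFun := shiftFun v
      map_add' := fun f g => by ext i; rfl
      map_smul' := fun c f => by ext i; rfl } 1 (fun f => by
        simpa using (norm_shiftFun v f).le)

theorem shift_apply (v : Lattice d) (f : L2 d) (i : Lattice d) : shift v f i = f (i - v) := rfl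

theorem norm_shift_le (v : Lattice d) : ‖shift v‖ ≤ 1 :=
  LinearMap.mkContinuous_norm_le _ zero_le_one _

theorem shift_single (v j : Lattice d) :
    shift v (lp.single 2 j (1 : ℝ)) = lp.single 2 (j + v) (1 : ℝ) := by
  ext i
  rw [shift_apply, lp.single_apply, lp.single_apply, Pi.single_apply, Pi.single_apply]
  simp only [sub_eq_iff_eq_add]

theorem shift_comm (v w : Lattice d) : Commute (shift v) (shift w) := by
  ext f i
  change f (i - v - w) = f (i - w - v)
  rw [sub_right_comm]

theorem inner_shift (v : Lattice d) (f g : L2 d) : ⟪shift v f, g⟫_ℝ = ⟪f, shift (-v) g⟫_ℝ := by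
  rw [lp.inner_eq_tsum, lp.inner_eq_tsum, ← (Equiv.addRight v).tsum_eq]
  refine tsum_congr fun i => ?_
  simp [shift_apply]

/-- The convolution operator with entries `φ_{i-j}`. -/
def conv (φ : nbhd d h → ℝ) : L2 d →L[ℝ] L2 d := ∑ i, φ i • shift (i : Lattice d)

theorem norm_conv_le (φ : nbhd d h → ℝ) : ‖conv φ‖ ≤ l1Norm φ := by
  refine (norm_sum_le _ _).trans (Finset.sum_le_sum fun i _ => ?_)
  rw [norm_smul, Real.norm_eq_abs]
  exact mul_le_of_le_one_right (abs_nonneg _) (norm_shift_le _)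

theorem commute_conv (φ : nbhd d h → ℝ) (v : Lattice d) : Commute (conv φ) (shift v) :=
  Commute.sum_left _ _ _ fun _ _ => (shift_comm _ _).smul_left _

theorem conv_entry (φ : nbhd d h → ℝ) (i j : Lattice d) :
    entry (conv φ) i j = if hv : i - j ∈ nbhd d h then φ ⟨i - j, hv⟩ else 0 := by
  have : entry (conv φ) i j = ∑ k, φ k * (if i - k = j then 1 else 0) := by
    simp only [entry, conv, sum_apply, lp.coeFn_sum, Finset.sum_apply]
    refine Finset.sum_congr rfl fun k _ => ?_
    change φ k * shift (k : Lattice d) (lp.single 2 j (1 : ℝ)) i = _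
    rw [shift_apply, lp.single_apply, Pi.single_apply]
  rw [this]
  split_ifs with hv
  · rw [Finset.sum_eq_single ⟨i - j, hv⟩]
    · simp
    · intro b _ hb
      rw [if_neg, mul_zero]
      rintro rfl
      exact hb (Subtype.ext (by simp))
    · simp
  · refine Finset.sum_eq_zero fun k _ => ?_
    rw [if_neg, mul_zero]
    rintro rfl
    exact hv (by simp)

theorem neg_mem {i : Lattice d} (hi : i ∈ nbhd d h) : -i ∈ nbhd d h := by
  simp only [nbhd, Finset.mem_erase, Finset.mem_Icc, Pi.le_def, ne_eq, neg_eq_zero,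
    Pi.neg_apply] at hi ⊢
  exact ⟨hi.1, fun k => by linarith [hi.2.2 k], fun k => by linarith [hi.2.1 k]⟩

theorem inner_conv (φ : nbhd d h → ℝ)
    (hs : ∀ i j : nbhd d h, (j : Lattice d) = -(i : Lattice d) → φ j = φ i) (f g : L2 d) :
    ⟪conv φ f, g⟫_ℝ = ⟪f, conv φ g⟫_ℝ := by
  simp only [conv, sum_apply, sum_inner, inner_sum,
    smul_apply, real_inner_smul_left, real_inner_smul_right, inner_shift]
  let e : nbhd d h ≃ nbhd d h :=
    ⟨fun i => ⟨-i.1, neg_mem i.2⟩, fun i => ⟨-i.1, neg_mem i.2⟩, fun i => by simp, fun i => by simp⟩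
  rw [← e.sum_comp (fun i => φ i * ⟪f, shift (i : Lattice d) g⟫_ℝ)]
  refine Finset.sum_congr rfl fun i _ => ?_
  rw [hs i (e i) rfl]
  rfl

theorem entry_eq_inner (A : L2 d →L[ℝ] L2 d) (i j : Lattice d) :
    entry A i j = ⟪lp.single 2 i (1 : ℝ), A (lp.single 2 j (1 : ℝ))⟫_ℝ := by
  rw [lp.inner_single_left]; simp [entry]

theorem entry_stationary {A : L2 d →L[ℝ] L2 d} (hA : ∀ v, Commute A (shift v))
    (i j v : Lattice d) : entry A (i + v) (j + v) = entry A i j := by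
  have : A (shift v (lp.single 2 j (1 : ℝ))) = shift v (A (lp.single 2 j (1 : ℝ))) :=
    congrArg (fun B : L2 d →L[ℝ] L2 d => B (lp.single 2 j (1 : ℝ))) (hA v)
  rw [entry, ← shift_single, this, shift_apply, add_sub_cancel_right, entry]

theorem one_sub_conv_entry (φ : nbhd d h → ℝ) (i j : Lattice d) : entry (1 - conv φ) i j =
    if i = j then 1 else if hv : i - j ∈ nbhd d h then -φ ⟨i - j, hv⟩ else 0 := by
  have h1 : entry (1 : L2 d →L[ℝ] L2 d) i j = if i = j then 1 else 0 := by
    change (lp.single 2 j (1 : ℝ) : L2 d) i = _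
    rw [lp.single_apply, Pi.single_apply]
  have h2 : entry (1 - conv φ) i j = entry (1 : L2 d →L[ℝ] L2 d) i j - entry (conv φ) i j := rfl
  rw [h2, h1, conv_entry]
  by_cases hij : i = j
  · subst hij
    simp [nbhd]
  · simp only [hij, if_false]
    split_ifs <;> simp

/-- `Φ_h` contains the symmetric vectors with `‖φ‖₁ < 1`. -/
theorem mem_paramSet (φ : nbhd d h → ℝ)
    (hs : ∀ i j : nbhd d h, (j : Lattice d) = -(i : Lattice d) → φ j = φ i)
    (h1 : l1Norm φ < 1) : φ ∈ paramSet d h := by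
  refine ⟨hs, ?_⟩
  have hK : ‖conv φ‖ < 1 := (norm_conv_le φ).trans_lt h1
  have hu : IsUnit (1 - conv φ) := isUnit_one_sub_of_norm_lt_one hK
  obtain ⟨u, hu⟩ := hu
  set B : L2 d →L[ℝ] L2 d := ↑u⁻¹ with hB
  have hAB : ∀ f, B f - conv φ (B f) = f := fun f => by
    have := congrArg (fun T : L2 d →L[ℝ] L2 d => T f) u.mul_inv
    rwa [hu] at this
  have hcomm : ∀ v, Commute B (shift v) := fun v => by
    have : Commute (u : L2 d →L[ℝ] L2 d) (shift v) := by
      rw [hu]; exact (Commute.one_left _).sub_left (commute_conv φ v)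
    exact this.units_inv_left
  have hlow : ∀ g : L2 d, (1 - ‖conv φ‖) * ‖g‖ ^ 2 ≤ ⟪g - conv φ g, g⟫_ℝ := fun g => by
    rw [inner_sub_left, real_inner_self_eq_norm_sq]
    have := (real_inner_le_norm (conv φ g) g).trans
      (mul_le_mul_of_nonneg_right ((conv φ).le_opNorm g) (norm_nonneg _))
    nlinarith
  have hpos : ∀ f, (1 - ‖conv φ‖) * ‖B f‖ ^ 2 ≤ ⟪B f, f⟫_ℝ := fun f => by
    have := hlow (B f)
    rwa [hAB, real_inner_comm] at this
  have hsym : ∀ f g, ⟪B f, g⟫_ℝ = ⟪f, B g⟫_ℝ := fun f g => by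
    conv_lhs => rw [← hAB g]
    conv_rhs => rw [← hAB f]
    rw [inner_sub_left, inner_sub_right, inner_conv φ hs]
  have hb : ∀ i, entry B i i = entry B 0 0 := fun i => by
    simpa using entry_stationary hcomm 0 0 i
  have hb0 : 0 < entry B 0 0 := by
    rw [entry_eq_inner, real_inner_comm]
    refine lt_of_lt_of_le ?_ (hpos _)
    refine mul_pos (sub_pos.mpr hK) (pow_pos (norm_pos_iff.mpr fun h0 => ?_) 2)
    have h2 := hAB (lp.single 2 0 (1 : ℝ))
    rw [h0, map_zero, sub_zero] at h2
    have := congrArg (fun f : L2 d => f 0) h2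
    simp at this
  set b := entry B 0 0
  have hsm : ∀ (c : ℝ) (T : L2 d →L[ℝ] L2 d) i j, entry (c • T) i j = c * entry T i j :=
    fun _ _ _ _ => rfl
  have hinv : Ring.inverse (b⁻¹ • B) = b • (1 - conv φ) := by
    let w : (L2 d →L[ℝ] L2 d)ˣ := ⟨b⁻¹ • B, b • (1 - conv φ), by
      rw [smul_mul_smul_comm, inv_mul_cancel₀ hb0.ne', one_smul, ← hu, hB, u.inv_mul], by
      rw [smul_mul_smul_comm, mul_inv_cancel₀ hb0.ne', one_smul, ← hu, hB, u.mul_inv]⟩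
    exact Ring.inverse_unit w
  refine ⟨b⁻¹ • B, ⟨?_, ?_, ?_, ?_, ?_⟩⟩
  · refine ContinuousLinearMap.IsPositive.smul_of_nonneg ?_ (inv_nonneg.mpr hb0.le)
    refine ⟨fun f g => hsym f g, fun f => ?_⟩
    exact (mul_nonneg (sub_pos.mpr hK).le (sq_nonneg _)).trans (hpos f)
  · intro i j v
    rw [hsm, hsm, entry_stationary hcomm]
  · intro i
    rw [hsm, hb, inv_mul_cancel₀ hb0.ne']
  · exact ((Units.mk0 b⁻¹ (inv_ne_zero hb0.ne')) • u⁻¹).isUnit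
  · intro i j
    rw [hinv, hsm, hsm, mul_div_mul_left _ _ hb0.ne', one_sub_conv_entry, one_sub_conv_entry φ i i, if_pos rfl, div_one]

theorem op_ext {A B : L2 d →L[ℝ] L2 d} (H : ∀ i j, entry A i j = entry B i j) : A = B := by
  refine ContinuousLinearMap.ext fun f => ?_
  have hf := lp.hasSum_single (E := fun _ : Lattice d => ℝ) (p := 2) (by norm_num) f
  have hj : ∀ j, A (lp.single 2 j (f j)) = B (lp.single 2 j (f j)) := fun j => by
    have h1 : (lp.single 2 j (f j) : L2 d) = f j • lp.single 2 j (1 : ℝ) := by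
      rw [← lp.single_smul, smul_eq_mul, mul_one]
    rw [h1, map_smul, map_smul]
    congr 1
    ext i
    exact H i j
  have hA := hf.mapL A
  have hB := hf.mapL B
  simp only [hj] at hA
  exact hA.unique hB

theorem commute_shift {A : L2 d →L[ℝ] L2 d}
    (hA : ∀ i j v, entry A (i + v) (j + v) = entry A i j) (v : Lattice d) :
    Commute A (shift v) := by
  refine op_ext fun i j => ?_
  change A (shift v (lp.single 2 j (1 : ℝ))) i = shift v (A (lp.single 2 j (1 : ℝ))) i
  rw [shift_single, shift_apply]
  have := hA (i - v) j v
  rwa [sub_add_cancel] at this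

/-- The covariance operator is determined by `φ`. -/
theorem IsGMRFCovariance.unique {φ : nbhd d h → ℝ} {Γ Γ' : L2 d →L[ℝ] L2 d}
    (H : IsGMRFCovariance φ Γ) (H' : IsGMRFCovariance φ Γ') : Γ = Γ' := by
  have key : ∀ T : L2 d →L[ℝ] L2 d, IsGMRFCovariance φ T →
      ∃ q : ℝ, q ≠ 0 ∧ T * (q • (1 - conv φ)) = 1 ∧ (q • (1 - conv φ)) * T = 1 := by
    intro T hT
    obtain ⟨u, rfl⟩ := hT.nonsingular
    have hR : Ring.inverse (u : L2 d →L[ℝ] L2 d) = ↑u⁻¹ := Ring.inverse_unit u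
    have hE := hT.inverse_entry
    rw [hR] at hE
    have hc : ∀ v, Commute (↑u⁻¹ : L2 d →L[ℝ] L2 d) (shift v) := fun v =>
      (commute_shift hT.stationary v).units_inv_left
    have hq : ∀ i, entry (↑u⁻¹ : L2 d →L[ℝ] L2 d) i i = entry (↑u⁻¹ : L2 d →L[ℝ] L2 d) 0 0 :=
      fun i => by simpa using entry_stationary hc 0 0 i
    have hq0 : entry (↑u⁻¹ : L2 d →L[ℝ] L2 d) 0 0 ≠ 0 := fun h0 => by
      have := hE 0 0
      simp [h0] at this
    have : (↑u⁻¹ : L2 d →L[ℝ] L2 d) = entry (↑u⁻¹ : L2 d →L[ℝ] L2 d) 0 0 • (1 - conv φ) := by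
      refine op_ext fun i j => ?_
      have h1 := hE i j
      rw [hq, div_eq_iff hq0, ← one_sub_conv_entry, mul_comm] at h1
      exact h1
    refine ⟨_, hq0, ?_, ?_⟩
    · rw [← this, u.mul_inv]
    · rw [← this, u.inv_mul]
  obtain ⟨q, hq, h1, -⟩ := key Γ H
  obtain ⟨q', hq', -, h2⟩ := key Γ' H'
  rw [mul_smul_comm] at h1
  rw [smul_mul_assoc] at h2
  have e : q • Γ = q' • Γ' := by
    rw [← one_mul (q' • Γ'), ← h1, smul_mul_assoc, mul_assoc, mul_smul_comm, h2, mul_one]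
  have e0 : q * entry Γ 0 0 = q' * entry Γ' 0 0 :=
    congrArg (fun T : L2 d →L[ℝ] L2 d => entry T 0 0) e
  rw [H.unit_variance, H'.unit_variance, mul_one, mul_one] at e0
  rw [← e0] at e
  exact smul_right_injective _ hq e

end WellDefined

/-- The finite lattice `𝒱 = {1, …, m}^d`. -/
abbrev Grid (d m : ℕ) : Type :=
  Finset.Icc (fun _ => 1 : Lattice d) (fun _ => (m : ℤ))

/-- A set of grid points, seen as a subset of `ℤ^d`. -/
def toLattice {d m : ℕ} (S : Finset (Grid d m)) : Set (Lattice d) :=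
  {j | ∃ i ∈ S, (i : Lattice d) = j}

open Classical in
/-- The `h`-boundary `Δ_h(S)`: the points of `S` at sup-norm distance at most `h` from
`ℤ^d \ S`. -/
def boundary {d m : ℕ} (h : ℕ) (S : Finset (Grid d m)) : Finset (Grid d m) :=
  S.filter fun i => ∃ j : Lattice d, j ∉ toLattice S ∧ dist (i : Lattice d) j ≤ h

/-- The `h`-interior `S^h = S \ Δ_h(S)`. -/
def interior {d m : ℕ} (h : ℕ) (S : Finset (Grid d m)) : Finset (Grid d m) :=
  S \ boundary h S

/-- The principal submatrix `Γ_S(φ)`. -/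
def GamS {d h m : ℕ} (φ : nbhd d h → ℝ) (S : Finset (Grid d m)) : Matrix S S ℝ :=
  Matrix.of fun i j => entry (Gam φ) i.1 j.1

/-- The covariance matrix of `X` when `S` is anomalous: `X_S` has covariance `Γ_S(φ)`, and the
remaining components are standard normal, uncorrelated with all other components. -/
def altCov {d h m : ℕ} (φ : nbhd d h → ℝ) (S : Finset (Grid d m)) :
    Matrix (Grid d m) (Grid d m) ℝ :=
  Matrix.of fun i j =>
    if i ∈ S ∧ j ∈ S then entry (Gam φ) i j else if i = j then 1 else 0

/-- The law `ℙ₀` of `X` under the null hypothesis: independent standard normal components. -/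
def nullLaw (d m : ℕ) : Measure (EuclideanSpace ℝ (Grid d m)) :=
  stdGaussian (EuclideanSpace ℝ (Grid d m))

/-- The law `ℙ_{S,φ}` of `X` when `S` is the anomalous set. -/
def altLaw {d h m : ℕ} (φ : nbhd d h → ℝ) (S : Finset (Grid d m)) :
    Measure (EuclideanSpace ℝ (Grid d m)) :=
  multivariateGaussian 0 (altCov φ S)

/-- The risk `R_{𝒞,φ}(f)`: the probability of type I error plus the maximal probability of type II
error of the test `f`, where `true` stands for rejection. -/
def risk {d h m : ℕ} (𝒞 : Finset (Finset (Grid d m))) (hne : 𝒞.Nonempty) (φ : nbhd d h → ℝ)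
    (f : EuclideanSpace ℝ (Grid d m) → Bool) : ℝ :=
  (nullLaw d m).real {x | f x = true} +
    𝒞.sup' hne fun S => (altLaw φ S).real {x | f x = false}

/-- The Frobenius norm. -/
def frobNorm {ι : Type} [Fintype ι] (A : Matrix ι ι ℝ) : ℝ :=
  Real.sqrt (∑ i, ∑ j, A i j ^ 2)

/-- The operator norm with respect to the Euclidean norm. -/
def opNorm {ι : Type} [Fintype ι] [DecidableEq ι] (A : Matrix ι ι ℝ) : ℝ :=
  ‖Matrix.toEuclideanCLM (𝕜 := ℝ) A‖

/-- The matrix `I_S - Γ_S⁻¹(φ)`. -/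
def quadMatrix {d h m : ℕ} (φ : nbhd d h → ℝ) (S : Finset (Grid d m)) : Matrix S S ℝ :=
  1 - (GamS φ S)⁻¹

/-- The restriction `x_S` of `x`. -/
def restr {d m : ℕ} (x : EuclideanSpace ℝ (Grid d m)) (S : Finset (Grid d m)) : S → ℝ :=
  fun i => x i.1

/-- The normalized generalized likelihood ratio statistic `U`. -/
def statU {d h m : ℕ} (𝒞 : Finset (Finset (Grid d m))) (hne : 𝒞.Nonempty) (φ : nbhd d h → ℝ)
    (x : EuclideanSpace ℝ (Grid d m)) : ℝ :=
  𝒞.sup' hne fun S =>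
    (restr x S ⬝ᵥ (quadMatrix φ S).mulVec (restr x S) - (quadMatrix φ S).trace) /
      (frobNorm (quadMatrix φ S) * Real.sqrt (Real.log 𝒞.card) +
        opNorm (quadMatrix φ S) * Real.log 𝒞.card)

open Classical in
/-- The test that rejects when `U > 4`. -/
def glrTest {d h m : ℕ} (𝒞 : Finset (Finset (Grid d m))) (hne : 𝒞.Nonempty) (φ : nbhd d h → ℝ)
    (x : EuclideanSpace ℝ (Grid d m)) : Bool :=
  decide (4 < statU 𝒞 hne φ x)

end HiddenGMRF

end

/-!
The statistic compares, for each `S ∈ 𝒞`, the centered quadratic form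
`x_Sᵀ (I - Γ_S⁻¹) x_S - tr (I - Γ_S⁻¹)` with its fluctuations, and the proof is a second-order
comparison of mean and fluctuations under the two hypotheses.

Both error probabilities are controlled by the Laurent–Massart bound for Gaussian quadratic forms
`Q`: `ℙ(Q - 𝔼 Q > 2 F √t + 2 b t) ≤ exp (-t)`, with `F` the Frobenius norm and `b` a bound on the
operator norm (`stdGaussian_quadForm_tail`). It follows by diagonalization and Chernoff's inequality
from the moment generating function of a centered chi-square variable. Under the null hypothesis,
`t = 2 log |𝒞|` and a union bound over `𝒞` give a type I error of at most `|𝒞|⁻¹`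
(`nullLaw_glrTest_le`). Under the alternative, `x_S = W z` with `W Wᵀ = Γ_S`, so the quadratic form
has mean `tr (Γ_S - I) = 0` and Frobenius norm `‖Γ_S - I‖_F`; with `t = log |𝒞|` the type II error
is at most `|𝒞|⁻¹` once `tr (Γ_S⁻¹ - I)` exceeds the threshold plus the fluctuations
(`altLaw_glrTest_le`).

It remains to compare these quantities with `N = ‖φ‖₂² |S|`. The inverse covariance is
`Γ⁻¹ = q (1 - K)` with `K` the convolution by `φ`, whose norm is at most `‖φ‖₁ ≤ η < 1`; hence
`Γ` is bounded above and below, and unit variance forces `q - 1 ≥ (1 - η) ‖φ‖₂² / 4`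
(`exists_scale_bounds`). At a point of `S^h` the Markov property makes the diagonal entry of `Γ_S⁻¹`
equal to `q`, while all its diagonal entries are at least `1`
(`inv_GamS_diag_of_mem_interior`, `one_le_inv_diag`). As `|S^h| ≥ |S| / 2`, the signal
`tr (Γ_S⁻¹ - I)` is at least `(1 - η) N / 8`. The squared Frobenius norms of `Γ_S - I` and
`I - Γ_S⁻¹` are at most a constant times `N`, and the operator norm of `I - Γ_S⁻¹` is at most a
constant. Since `log |𝒞| ≤ N / C₀`, threshold and fluctuations are of order `N / √C₀`
(`noise_lt_signal`).
-/

noncomputable section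

namespace HiddenGMRF

/-! ### Concentration of Gaussian quadratic forms -/

theorem integral_exp_mul_sq_sub_one_gaussianReal {u : ℝ} (hu : u < 1 / 2) :
    ∫ x, Real.exp (u * (x ^ 2 - 1)) ∂(gaussianReal 0 1) =
      Real.exp (-u) * (Real.sqrt (1 - 2 * u))⁻¹ := by
  rw [integral_gaussianReal_eq_integral_smul one_ne_zero]
  have h1 : ∀ x : ℝ, gaussianPDFReal 0 1 x • Real.exp (u * (x ^ 2 - 1)) =
      ((Real.sqrt (2 * Real.pi))⁻¹ * Real.exp (-u)) * Real.exp (-(1 / 2 - u) * x ^ 2) := by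
    intro x
    simp only [gaussianPDFReal, smul_eq_mul, NNReal.coe_one, mul_one, sub_zero]
    rw [mul_assoc, mul_assoc, ← Real.exp_add, ← Real.exp_add]
    ring_nf
  simp_rw [h1]
  rw [integral_const_mul, integral_gaussian, mul_comm _ (Real.exp (-u)), mul_assoc]
  congr 1
  have hp := Real.pi_pos
  rw [← Real.sqrt_inv, ← Real.sqrt_inv, ← Real.sqrt_mul (by positivity)]
  congr 1
  have : 1 - 2 * u ≠ 0 := by linarith
  have : 1 / 2 - u ≠ 0 := by linarith
  field_simp

/-- The two cases compare the logarithm with `sinh` (for `u ≥ 0`) and with its Padé approximant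
(for `u < 0`). -/
theorem neg_log_one_sub_two_mul_le {u : ℝ} (hu : |u| < 1 / 2) :
    -u - Real.log (1 - 2 * u) / 2 ≤ u ^ 2 / (1 - 2 * |u|) := by
  rcases le_or_gt 0 u with h0 | h0
  · rw [abs_of_nonneg h0] at hu ⊢
    have hp : 0 < 1 - 2 * u := by linarith
    have h1 : 0 ≤ -Real.log (1 - 2 * u) := by
      have := Real.log_nonpos hp.le (by linarith)
      linarith
    have h2 := Real.self_le_sinh_iff.2 h1
    rw [Real.sinh_eq, neg_neg, Real.exp_neg, Real.exp_log hp] at h2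
    have h3 : u ^ 2 / (1 - 2 * u) = -u + ((1 - 2 * u)⁻¹ - (1 - 2 * u)) / 2 / 2 := by
      have hinv := inv_mul_cancel₀ hp.ne'
      rw [div_eq_iff hp.ne']
      linear_combination (-1 / 4) * hinv
    rw [h3]
    linarith
  · rw [abs_of_neg h0] at hu ⊢
    have h1 := Real.le_log_one_add_of_nonneg (x := -2 * u) (by linarith)
    have h2 : -2 * u - 2 * u ^ 2 ≤ 2 * (-2 * u) / (-2 * u + 2) := by
      rw [le_div_iff₀ (by linarith)]
      nlinarith [mul_nonneg (neg_nonneg.2 h0.le) (sq_nonneg u)]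
    have h3 : u ^ 2 ≤ u ^ 2 / (1 - 2 * -u) := by
      rw [le_div_iff₀ (by linarith)]
      nlinarith [sq_nonneg u]
    rw [show (1 : ℝ) + -2 * u = 1 - 2 * u by ring] at h1
    linarith

theorem integral_exp_mul_sq_sub_one_gaussianReal_le {u : ℝ} (hu : |u| < 1 / 2) :
    ∫ x, Real.exp (u * (x ^ 2 - 1)) ∂(gaussianReal 0 1) ≤
      Real.exp (u ^ 2 / (1 - 2 * |u|)) := by
  have hu' : u < 1 / 2 := (le_abs_self u).trans_lt hu
  rw [integral_exp_mul_sq_sub_one_gaussianReal hu']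
  refine le_trans (le_of_eq ?_) (Real.exp_le_exp.2 (neg_log_one_sub_two_mul_le hu))
  have hp : 0 < 1 - 2 * u := by linarith
  rw [← Real.log_sqrt hp.le, sub_eq_add_neg (-u), Real.exp_add, Real.exp_neg (Real.log _),
    Real.exp_log (Real.sqrt_pos.2 hp)]

/-- The Laurent–Massart upper tail bound for a weighted sum of centered chi-square variables.
The weights may have any sign. -/
theorem pi_gaussianReal_weighted_sq_tail {ι : Type*} [Fintype ι] (l : ι → ℝ) {F b t : ℝ}
    (hF : 0 ≤ F) (hb : 0 ≤ b) (ht : 0 ≤ t) (hlF : ∑ i, l i ^ 2 ≤ F ^ 2) (hlb : ∀ i, |l i| ≤ b) :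
    (Measure.pi fun _ : ι => gaussianReal 0 1).real
      {x | 2 * F * Real.sqrt t + 2 * b * t < ∑ i, l i * (x i ^ 2 - 1)} ≤ Real.exp (-t) := by
  rcases hF.eq_or_lt with rfl | hF
  · have hl : ∀ i, l i = 0 := fun i => by
      have h1 := (Finset.single_le_sum (f := fun i => l i ^ 2) (fun i _ => sq_nonneg _)
        (Finset.mem_univ i)).trans hlF
      have h2 : l i ^ 2 ≤ 0 := by simpa using h1
      exact pow_eq_zero_iff two_ne_zero |>.1 (le_antisymm h2 (sq_nonneg _))
    have : {x : ι → ℝ | 2 * 0 * Real.sqrt t + 2 * b * t < ∑ i, l i * (x i ^ 2 - 1)} = ∅ := by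
      ext x
      simp only [hl, zero_mul, Finset.sum_const_zero, mul_zero, zero_add, Set.mem_ofPred_eq,
        Set.mem_empty_iff_false, iff_false, not_lt]
      positivity
    rw [this, measureReal_empty]
    positivity
  set r := Real.sqrt t with hr
  have hr0 : 0 ≤ r := Real.sqrt_nonneg t
  have htr : t = r ^ 2 := (Real.sq_sqrt ht).symm
  have hD : 0 < F + 2 * b * r := by positivity
  -- The minimizer of the Chernoff exponent `s ^ 2 * F ^ 2 / (1 - 2 * b * s) - s * x`.
  set s := r / (F + 2 * b * r) with hs
  have hs0 : 0 ≤ s := by positivity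
  have hsb : 1 - 2 * (s * b) = F / (F + 2 * b * r) := by
    rw [hs]
    field_simp
    ring
  have hsb0 : 0 < 1 - 2 * (s * b) := by rw [hsb]; positivity
  have hsl : ∀ i, |s * l i| ≤ s * b := fun i => by
    rw [abs_mul, abs_of_nonneg hs0]
    exact mul_le_mul_of_nonneg_left (hlb i) hs0
  have hsl2 : ∀ i, |s * l i| < 1 / 2 := fun i => (hsl i).trans_lt (by linarith)
  set μ := Measure.pi fun _ : ι => gaussianReal 0 1
  set X : (ι → ℝ) → ℝ := fun x => ∑ i, l i * (x i ^ 2 - 1) with hX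
  have hexp : ∀ x, Real.exp (s * X x) = ∏ i, Real.exp (s * l i * (x i ^ 2 - 1)) := fun x => by
    rw [← Real.exp_sum, hX, Finset.mul_sum]
    congr 1
    exact Finset.sum_congr rfl fun i _ => by ring
  have hint : ∫ x, Real.exp (s * X x) ∂μ =
      ∏ i, ∫ y, Real.exp (s * l i * (y ^ 2 - 1)) ∂(gaussianReal 0 1) := by
    simp_rw [hexp]
    exact integral_fintype_prod_eq_prod (fun i (y : ℝ) => Real.exp (s * l i * (y ^ 2 - 1)))
  have hpos : ∀ i, 0 < ∫ y, Real.exp (s * l i * (y ^ 2 - 1)) ∂(gaussianReal 0 1) := fun i => by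
    have h1 : s * l i < 1 / 2 := (le_abs_self _).trans_lt (hsl2 i)
    rw [integral_exp_mul_sq_sub_one_gaussianReal h1]
    have : 0 < 1 - 2 * (s * l i) := by linarith
    positivity
  -- A non-integrable function would have integral `0`, but the product is positive.
  have hI : Integrable (fun x => Real.exp (s * X x)) μ := by
    by_contra hcon
    have h1 := integral_undef hcon
    rw [hint] at h1
    exact (Finset.prod_pos fun i _ => hpos i).ne' h1
  have hmgf : mgf X μ s ≤ Real.exp (s ^ 2 * F ^ 2 / (1 - 2 * (s * b))) := by
    have h1 : mgf X μ s = ∫ x, Real.exp (s * X x) ∂μ := rfl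
    rw [h1, hint]
    refine (Finset.prod_le_prod (g := fun i => Real.exp (s ^ 2 * l i ^ 2 / (1 - 2 * (s * b))))
      (fun i _ => (hpos i).le) fun i _ =>
      (integral_exp_mul_sq_sub_one_gaussianReal_le (hsl2 i)).trans ?_).trans ?_
    · rw [Real.exp_le_exp, mul_pow]
      exact div_le_div_of_nonneg_left (by positivity) hsb0 (by linarith [hsl i])
    · rw [← Real.exp_sum, Real.exp_le_exp, ← Finset.sum_div, ← Finset.mul_sum]
      gcongr
  refine (measureReal_mono (fun x hx => ?_) (measure_ne_top μ _)).trans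
    ((measure_ge_le_exp_mul_mgf (μ := μ) (X := X) (2 * F * r + 2 * b * t) hs0 hI).trans ?_)
  · exact (show 2 * F * r + 2 * b * t < X x from hx).le
  refine (mul_le_mul_of_nonneg_left hmgf (Real.exp_pos _).le).trans ?_
  rw [← Real.exp_add, Real.exp_le_exp, hsb, hs, htr]
  apply le_of_eq
  field_simp
  ring

theorem trace_mul_self_eq_sum_sq_eigenvalues {ι : Type*} [Fintype ι] [DecidableEq ι]
    {B : Matrix ι ι ℝ} (hB : B.IsHermitian) : (B * B).trace = ∑ i, hB.eigenvalues i ^ 2 := by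
  conv_lhs => rw [hB.spectral_theorem]
  rw [← map_mul, Unitary.conjStarAlgAut_apply, Matrix.trace_mul_comm, ← mul_assoc,
    Unitary.coe_star_mul_self, one_mul, Matrix.diagonal_mul_diagonal, Matrix.trace_diagonal]
  exact Finset.sum_congr rfl fun i _ => by simp [sq]

theorem quadForm_eigenvectorBasis {ι : Type*} [Fintype ι] [DecidableEq ι]
    {B : Matrix ι ι ℝ} (hB : B.IsHermitian) (x : ι → ℝ) :
    (∑ i, x i • hB.eigenvectorBasis i).ofLp ⬝ᵥ
      B.mulVec (∑ i, x i • hB.eigenvectorBasis i).ofLp = ∑ i, hB.eigenvalues i * x i ^ 2 := by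
  have h1 : B.mulVec (∑ i, x i • hB.eigenvectorBasis i).ofLp =
      (∑ i, (x i * hB.eigenvalues i) • hB.eigenvectorBasis i).ofLp := by
    simp only [WithLp.ofLp_sum, WithLp.ofLp_smul, Matrix.mulVec_sum, Matrix.mulVec_smul,
      hB.mulVec_eigenvectorBasis, smul_smul]
  rw [h1, dotProduct_comm]
  have h2 := hB.eigenvectorBasis.orthonormal.inner_sum x (fun i => x i * hB.eigenvalues i)
    Finset.univ
  rw [EuclideanSpace.inner_eq_star_dotProduct] at h2
  simp only [star_trivial] at h2
  rw [h2]
  exact Finset.sum_congr rfl fun i _ => by simp; ring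

/-- Diagonalizing `B` and using the rotation invariance of the standard Gaussian law reduces the
centered quadratic form to a weighted sum of centered chi-square variables. -/
theorem stdGaussian_quadForm_tail {ι : Type*} [Fintype ι] [DecidableEq ι] {B : Matrix ι ι ℝ}
    (hB : B.IsHermitian) {F b t : ℝ} (hF : 0 ≤ F) (hb : 0 ≤ b) (ht : 0 ≤ t)
    (hBF : (B * B).trace ≤ F ^ 2) (hBb : ∀ v : ι → ℝ, |v ⬝ᵥ B.mulVec v| ≤ b * (v ⬝ᵥ v)) :
    (stdGaussian (EuclideanSpace ℝ ι)).real
      {z | 2 * F * Real.sqrt t + 2 * b * t < z.ofLp ⬝ᵥ B.mulVec z.ofLp - B.trace} ≤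
      Real.exp (-t) := by
  have hlb : ∀ i, |hB.eigenvalues i| ≤ b := fun i => by
    have h1 := hBb (hB.eigenvectorBasis i).ofLp
    have h2 : (hB.eigenvectorBasis i).ofLp ⬝ᵥ (hB.eigenvectorBasis i).ofLp = 1 := by
      have := EuclideanSpace.inner_eq_star_dotProduct (hB.eigenvectorBasis i)
        (hB.eigenvectorBasis i)
      rw [star_trivial, real_inner_self_eq_norm_sq, hB.eigenvectorBasis.orthonormal.1 i] at this
      simpa using this.symm
    have h3 : (hB.eigenvectorBasis i).ofLp ⬝ᵥ B.mulVec (hB.eigenvectorBasis i).ofLp =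
        hB.eigenvalues i := by
      rw [hB.eigenvalues_eq i, star_trivial]
      rfl
    rwa [h2, h3, mul_one] at h1
  have hm : Measurable fun x : ι → ℝ => ∑ i, x i • hB.eigenvectorBasis i := by fun_prop
  have hmeas : MeasurableSet {z : EuclideanSpace ℝ ι | 2 * F * Real.sqrt t + 2 * b * t <
      z.ofLp ⬝ᵥ B.mulVec z.ofLp - B.trace} := by
    refine measurableSet_lt measurable_const ?_
    simp only [dotProduct, Matrix.mulVec]
    fun_prop
  rw [stdGaussian_eq_map_pi_orthonormalBasis hB.eigenvectorBasis, map_measureReal_apply hm hmeas]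
  refine le_trans (le_of_eq ?_) (pi_gaussianReal_weighted_sq_tail hB.eigenvalues hF hb ht
    ((trace_mul_self_eq_sum_sq_eigenvalues hB).symm.trans_le hBF) hlb)
  congr 1
  ext x
  simp only [Set.mem_preimage, Set.mem_ofPred_eq]
  rw [quadForm_eigenvectorBasis, hB.trace_eq_sum_eigenvalues]
  simp [mul_sub, Finset.sum_sub_distrib]

/-! ### The covariance operator -/

section Operator

open scoped InnerProductSpace

variable {d h : ℕ}

/-- The inverse of the covariance operator is a multiple of `1 - conv φ`. -/
theorem IsGMRFCovariance.exists_scale {φ : nbhd d h → ℝ} {Γ : L2 d →L[ℝ] L2 d}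
    (H : IsGMRFCovariance φ Γ) :
    ∃ q : ℝ, (∀ f, Γ (q • (f - conv φ f)) = f) ∧ ∀ f, q • (Γ f - conv φ (Γ f)) = f := by
  obtain ⟨u, hu⟩ := H.nonsingular
  have hR : Ring.inverse Γ = ↑u⁻¹ := by rw [← hu]; exact Ring.inverse_unit u
  have hE := H.inverse_entry
  rw [hR] at hE
  have hc : ∀ v, Commute (↑u⁻¹ : L2 d →L[ℝ] L2 d) (shift v) := fun v => by
    have h1 := commute_shift H.stationary v
    rw [← hu] at h1
    exact h1.units_inv_left
  have hq : ∀ i, entry (↑u⁻¹ : L2 d →L[ℝ] L2 d) i i = entry (↑u⁻¹ : L2 d →L[ℝ] L2 d) 0 0 :=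
    fun i => by simpa using entry_stationary hc 0 0 i
  have hq0 : entry (↑u⁻¹ : L2 d →L[ℝ] L2 d) 0 0 ≠ 0 := fun h0 => by
    have := hE 0 0
    simp [h0] at this
  have hinv : (↑u⁻¹ : L2 d →L[ℝ] L2 d) =
      entry (↑u⁻¹ : L2 d →L[ℝ] L2 d) 0 0 • (1 - conv φ) := by
    refine op_ext fun i j => ?_
    have h1 := hE i j
    rw [hq, div_eq_iff hq0, ← one_sub_conv_entry, mul_comm] at h1
    exact h1
  have hm : Γ * (↑u⁻¹ : L2 d →L[ℝ] L2 d) = 1 := by rw [← hu, u.mul_inv]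
  have hm' : (↑u⁻¹ : L2 d →L[ℝ] L2 d) * Γ = 1 := by rw [← hu, u.inv_mul]
  rw [hinv] at hm hm'
  exact ⟨_, fun f => congrArg (fun T : L2 d →L[ℝ] L2 d => T f) hm,
    fun f => congrArg (fun T : L2 d →L[ℝ] L2 d => T f) hm'⟩

theorem norm_single_one (j : Lattice d) : ‖(lp.single 2 j (1 : ℝ) : L2 d)‖ = 1 := by
  rw [lp.norm_single (by norm_num), norm_one]

theorem conv_single (φ : nbhd d h → ℝ) (j : Lattice d) :
    conv φ (lp.single 2 j (1 : ℝ)) = ∑ k, φ k • lp.single 2 (j + (k : Lattice d)) (1 : ℝ) := by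
  simp only [conv, sum_apply, smul_apply, shift_single]

theorem norm_conv_single (φ : nbhd d h → ℝ) (j : Lattice d) :
    ‖conv φ (lp.single 2 j (1 : ℝ))‖ = l2Norm φ := by
  rw [l2Norm, ← Real.sqrt_sq (norm_nonneg _), ← real_inner_self_eq_norm_sq]
  congr 1
  conv_lhs => rw [conv_single, sum_inner]
  refine Finset.sum_congr rfl fun k _ => ?_
  rw [real_inner_smul_left, ← conv_single, ← entry_eq_inner, conv_entry, dif_pos (by simp)]
  simp [sq]

theorem inner_single_conv_single (φ : nbhd d h → ℝ) (j : Lattice d) :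
    ⟪lp.single 2 j (1 : ℝ), conv φ (lp.single 2 j (1 : ℝ))⟫_ℝ = 0 := by
  rw [← entry_eq_inner, conv_entry, dif_neg (by simp [nbhd])]

/-- The spectral information on `Γ(φ)` that the test needs, with `q` the diagonal value of
`Γ(φ)⁻¹`. Since `Γ = q⁻¹ (1 + K) + K Γ K` with `K = conv φ`, and `K` has zero diagonal, unit
variance gives `q - 1 = q ⟪K e, Γ K e⟫` for a basis vector `e`. -/
theorem exists_scale_bounds {φ : nbhd d h → ℝ} (hφ : φ ∈ paramSet d h) {η : ℝ} (hη : η < 1)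
    (h1 : l1Norm φ ≤ η) :
    ∃ q : ℝ, 1 + (1 - η) / 4 * l2Norm φ ^ 2 ≤ q ∧
      (∀ f, Gam φ (q • (f - conv φ f)) = f) ∧
      (∀ f, ‖Gam φ f‖ ≤ (1 - η)⁻¹ * ‖f‖) ∧
      (∀ f, (1 - η) ^ 2 / 4 * ‖f‖ ^ 2 ≤ ⟪f, Gam φ f⟫_ℝ) ∧
      ∀ j, ‖Gam φ (lp.single 2 j (1 : ℝ)) - q⁻¹ • lp.single 2 j (1 : ℝ)‖ ≤
        (1 - η)⁻¹ * l2Norm φ := by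
  have H := isGMRFCovariance_Gam hφ
  set Γ := Gam φ
  set K := conv φ
  have hK : ‖K‖ ≤ η := (norm_conv_le φ).trans h1
  have hη0 : 0 ≤ η := (norm_nonneg _).trans hK
  have ha : 0 < 1 - η := by linarith
  have hKf : ∀ f, ‖K f‖ ≤ η * ‖f‖ := fun f =>
    (K.le_opNorm f).trans (mul_le_mul_of_nonneg_right hK (norm_nonneg _))
  obtain ⟨q, hq1, hq2⟩ := H.exists_scale
  have hΓsym : ∀ f g, ⟪Γ f, g⟫_ℝ = ⟪f, Γ g⟫_ℝ := fun f g => H.isPositive.isSymmetric f g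
  have hKsym : ∀ f g, ⟪K f, g⟫_ℝ = ⟪f, K g⟫_ℝ := inner_conv φ hφ.1
  have hΓpos : ∀ f, 0 ≤ ⟪Γ f, f⟫_ℝ := fun f => H.isPositive.inner_nonneg_left f
  set e : L2 d := lp.single 2 0 (1 : ℝ)
  have hen : ‖e‖ = 1 := norm_single_one 0
  have hKe : ⟪e, K e⟫_ℝ = 0 := inner_single_conv_single φ 0
  have hvar : ⟪e, Γ e⟫_ℝ = 1 := by rw [← entry_eq_inner]; exact H.unit_variance 0
  have hq0 : 0 ≤ q := by
    have h2 := hΓpos (q • (e - K e))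
    rw [hq1, real_inner_smul_right, inner_sub_right, hKe, real_inner_self_eq_norm_sq, hen] at h2
    simpa using h2
  have hqne : q ≠ 0 := fun h0 => by
    have := hq2 e
    rw [h0, zero_smul] at this
    rw [← this, norm_zero] at hen
    exact zero_ne_one hen
  have hqpos : 0 < q := lt_of_le_of_ne hq0 hqne.symm
  have hΓ : ∀ f, Γ f = q⁻¹ • f + K (Γ f) := fun f => by
    have := hq2 f
    rw [eq_comm, ← inv_smul_eq_iff₀ hqne] at this
    rw [this]; abel
  have hΓ' : ∀ f, Γ f = q⁻¹ • f + Γ (K f) := fun f => by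
    have h2 := hq1 f
    rw [map_smul, eq_comm, ← inv_smul_eq_iff₀ hqne, map_sub] at h2
    rw [h2]; abel
  have hqe : q - 1 = q * ⟪K e, Γ (K e)⟫_ℝ := by
    have h2 : ⟪e, Γ e⟫_ℝ = q⁻¹ + ⟪K e, Γ (K e)⟫_ℝ := by
      have h3 : ⟪e, Γ (K e)⟫_ℝ = q⁻¹ * ⟪e, K e⟫_ℝ + ⟪e, K (Γ (K e))⟫_ℝ := by
        conv_lhs => rw [hΓ (K e)]
        rw [inner_add_right, real_inner_smul_right]
      rw [hΓ' e, inner_add_right, real_inner_smul_right, h3, hKe, real_inner_self_eq_norm_sq,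
        hen, hKsym]
      ring
    rw [hvar] at h2
    field_simp at h2
    linarith
  have hqge : 1 ≤ q := by
    have h2 : 0 ≤ ⟪K e, Γ (K e)⟫_ℝ := by rw [← hΓsym]; exact hΓpos _
    nlinarith [mul_nonneg hq0 h2]
  have hup : ∀ f, q * (1 - η) * ‖Γ f‖ ≤ ‖f‖ := fun f => by
    have h2 : ‖f‖ = q * ‖Γ f - K (Γ f)‖ := by
      conv_lhs => rw [← hq2 f]
      rw [norm_smul, Real.norm_of_nonneg hq0]
    have h3 := norm_sub_norm_le (Γ f) (K (Γ f))
    have h4 := hKf (Γ f)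
    rw [h2, mul_assoc]
    exact mul_le_mul_of_nonneg_left (by linarith) hq0
  have hlow : ∀ f, ‖f‖ ≤ q * 2 * ‖Γ f‖ := fun f => by
    have h2 : ‖f‖ = q * ‖Γ f - K (Γ f)‖ := by
      conv_lhs => rw [← hq2 f]
      rw [norm_smul, Real.norm_of_nonneg hq0]
    have h3 := norm_sub_le (Γ f) (K (Γ f))
    have h4 := hKf (Γ f)
    rw [h2, mul_assoc]
    refine mul_le_mul_of_nonneg_left ?_ hq0
    nlinarith [norm_nonneg (Γ f)]
  have hΓn : ∀ f, ‖Γ f‖ ≤ (1 - η)⁻¹ * ‖f‖ := fun f => by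
    rw [inv_mul_eq_div, le_div_iff₀ ha]
    refine le_trans ?_ (hup f)
    nlinarith [mul_nonneg (norm_nonneg (Γ f)) ha.le]
  have hqle : q * (1 - η) ≤ 1 := by
    have h2 := hup e
    have h3 := real_inner_le_norm e (Γ e)
    rw [hvar, hen, one_mul] at h3
    rw [hen] at h2
    nlinarith [mul_pos hqpos ha]
  have hcoer : ∀ f, (1 - η) / 4 * ‖f‖ ^ 2 ≤ q * ⟪f, Γ f⟫_ℝ := fun f => by
    have h2 : ⟪f, Γ f⟫_ℝ = q * (‖Γ f‖ ^ 2 - ⟪K (Γ f), Γ f⟫_ℝ) := by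
      have h3 := congrArg (fun g => ⟪g, Γ f⟫_ℝ) (hq2 f).symm
      rwa [real_inner_smul_left, inner_sub_left, real_inner_self_eq_norm_sq] at h3
    have h3 := real_inner_le_norm (K (Γ f)) (Γ f)
    have h4 := mul_le_mul_of_nonneg_right (hKf (Γ f)) (norm_nonneg (Γ f))
    have h5 : ‖f‖ ^ 2 ≤ (q * 2 * ‖Γ f‖) ^ 2 :=
      pow_le_pow_left₀ (norm_nonneg _) (hlow f) 2
    calc (1 - η) / 4 * ‖f‖ ^ 2 ≤ (1 - η) / 4 * (q * 2 * ‖Γ f‖) ^ 2 :=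
          mul_le_mul_of_nonneg_left h5 (by linarith)
      _ = q * (q * ((1 - η) * ‖Γ f‖ ^ 2)) := by ring
      _ ≤ q * ⟪f, Γ f⟫_ℝ := by
          rw [h2]
          refine mul_le_mul_of_nonneg_left (mul_le_mul_of_nonneg_left ?_ hq0) hq0
          nlinarith
  refine ⟨q, ?_, hq1, hΓn, fun f => ?_, fun j => ?_⟩
  · have h2 := hcoer (K e)
    rw [show ‖K e‖ = l2Norm φ from norm_conv_single φ 0, ← hqe] at h2
    linarith
  · have h2 := hcoer f
    have h3 : 0 ≤ ⟪f, Γ f⟫_ℝ := by rw [← hΓsym]; exact hΓpos _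
    have h4 := mul_le_mul_of_nonneg_right hqle h3
    nlinarith
  · rw [hΓ' (lp.single 2 j (1 : ℝ)), add_sub_cancel_left, ← norm_conv_single φ j]
    exact hΓn _

end Operator

/-! ### Principal submatrices of the covariance operator -/

section Submatrix

open scoped InnerProductSpace

variable {d h m : ℕ}

/-- A vector indexed by `S`, extended by zero to an element of `ℓ²(ℤ^d)`. -/
def extendZero (S : Finset (Grid d m)) (v : S → ℝ) : L2 d :=
  ∑ i, v i • lp.single 2 (i.1 : Lattice d) (1 : ℝ)

theorem inner_single_extendZero (S : Finset (Grid d m)) (v : S → ℝ) (i : S) :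
    ⟪lp.single 2 (i.1 : Lattice d) (1 : ℝ), extendZero S v⟫_ℝ = v i := by
  rw [extendZero, inner_sum, Finset.sum_eq_single i]
  · rw [real_inner_smul_right, real_inner_self_eq_norm_sq, norm_single_one]
    simp
  · intro j _ hj
    rw [real_inner_smul_right, lp.inner_single_left, lp.single_apply, Pi.single_apply, if_neg]
    · simp
    · exact fun hij => hj (Subtype.ext (Subtype.ext hij.symm))
  · simp

theorem inner_extendZero_left (S : Finset (Grid d m)) (v : S → ℝ) (f : L2 d) :
    ⟪extendZero S v, f⟫_ℝ = ∑ i, v i * f (i.1 : Lattice d) := by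
  rw [extendZero, sum_inner]
  refine Finset.sum_congr rfl fun i _ => ?_
  rw [real_inner_smul_left, lp.inner_single_left]
  simp

theorem norm_extendZero_sq (S : Finset (Grid d m)) (v : S → ℝ) :
    ‖extendZero S v‖ ^ 2 = v ⬝ᵥ v := by
  rw [← real_inner_self_eq_norm_sq]
  conv_lhs => rw [extendZero, sum_inner]
  refine Finset.sum_congr rfl fun i _ => ?_
  rw [real_inner_smul_left, ← extendZero, inner_single_extendZero]

theorem Gam_extendZero_apply (φ : nbhd d h → ℝ) (S : Finset (Grid d m)) (v : S → ℝ) (i : S) :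
    Gam φ (extendZero S v) (i.1 : Lattice d) = (GamS φ S).mulVec v i := by
  rw [extendZero, map_sum, lp.coeFn_sum, Finset.sum_apply]
  refine Finset.sum_congr rfl fun j _ => ?_
  rw [map_smul]
  change v j * entry (Gam φ) i.1 j.1 = entry (Gam φ) i.1 j.1 * v j
  rw [mul_comm]

theorem dotProduct_GamS_mulVec (φ : nbhd d h → ℝ) (S : Finset (Grid d m)) (v : S → ℝ) :
    v ⬝ᵥ (GamS φ S).mulVec v = ⟪extendZero S v, Gam φ (extendZero S v)⟫_ℝ := by
  rw [inner_extendZero_left]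
  exact Finset.sum_congr rfl fun i _ => by rw [Gam_extendZero_apply]

theorem isHermitian_GamS {φ : nbhd d h → ℝ} (hφ : φ ∈ paramSet d h) (S : Finset (Grid d m)) :
    (GamS φ S).IsHermitian := by
  ext i j
  simp only [Matrix.conjTranspose_apply, star_trivial, GamS, Matrix.of_apply, entry_eq_inner]
  rw [real_inner_comm]
  exact (isGMRFCovariance_Gam hφ).isPositive.isSymmetric _ _

theorem GamS_diag {φ : nbhd d h → ℝ} (hφ : φ ∈ paramSet d h) (S : Finset (Grid d m)) (i : S) :
    GamS φ S i i = 1 :=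
  (isGMRFCovariance_Gam hφ).unit_variance _

theorem posDef_GamS {φ : nbhd d h → ℝ} (hφ : φ ∈ paramSet d h) {S : Finset (Grid d m)} {c : ℝ}
    (hc : 0 < c) (hlow : ∀ f, c * ‖f‖ ^ 2 ≤ ⟪f, Gam φ f⟫_ℝ) : (GamS φ S).PosDef := by
  refine Matrix.PosDef.of_dotProduct_mulVec_pos (isHermitian_GamS hφ S) fun v hv => ?_
  rw [star_trivial, dotProduct_GamS_mulVec]
  refine lt_of_lt_of_le (mul_pos hc ?_) (hlow _)
  rw [norm_extendZero_sq]
  exact lt_of_le_of_ne (Finset.sum_nonneg fun i _ => mul_self_nonneg (v i))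
    fun h0 => hv (dotProduct_self_eq_zero.1 h0.symm)

/-- The inverse of a positive definite matrix with unit diagonal has diagonal entries at least `1`:
expand the quadratic form at `e_i - G⁻¹ e_i`. -/
theorem one_le_inv_diag {ι : Type*} [Fintype ι] [DecidableEq ι] {G : Matrix ι ι ℝ}
    (hG : G.PosDef) {i : ι} (hi : G i i = 1) : 1 ≤ G⁻¹ i i := by
  have hdet : IsUnit G.det := (Matrix.isUnit_iff_isUnit_det _).1 hG.isUnit
  set e : ι → ℝ := Pi.single i 1 with he
  have h1 := hG.posSemidef.dotProduct_mulVec_nonneg (e - G⁻¹.mulVec e)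
  have h2 : G.mulVec (G⁻¹.mulVec e) = e := by
    rw [Matrix.mulVec_mulVec, Matrix.mul_nonsing_inv _ hdet, Matrix.one_mulVec]
  have h3 : G⁻¹.mulVec e ⬝ᵥ G.mulVec e = 1 := by
    have hT : G.transpose = G := by simpa using hG.isHermitian.eq
    rw [Matrix.dotProduct_mulVec, ← Matrix.mulVec_transpose, hT, h2]
    simp [he]
  rw [star_trivial, Matrix.mulVec_sub, h2, sub_dotProduct, dotProduct_sub, dotProduct_sub, h3]
    at h1
  have h4 : e ⬝ᵥ G.mulVec e = 1 := by simp [he, hi]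
  have h5 : e ⬝ᵥ e = 1 := by simp [he]
  have h6 : G⁻¹.mulVec e ⬝ᵥ e = G⁻¹ i i := by simp [he]
  rw [h4, h5, h6] at h1
  linarith

/-- The Markov property: at a point of the interior of `S`, the column of `Γ⁻¹` is supported
on `S`, hence it is the column of `Γ_S⁻¹`. -/
theorem inv_GamS_diag_of_mem_interior {φ : nbhd d h → ℝ} {S : Finset (Grid d m)}
    (hdet : IsUnit (GamS φ S).det) {q : ℝ} (hq : ∀ f, Gam φ (q • (f - conv φ f)) = f)
    (i : S) (hi : i.1 ∈ interior h S) : (GamS φ S)⁻¹ i i = q := by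
  have hnb : ∀ k : nbhd d h, (i.1 : Lattice d) + k ∈ toLattice S := by
    intro k
    by_contra hk
    refine (Finset.mem_sdiff.1 hi).2 ?_
    simp only [boundary, Finset.mem_filter]
    refine ⟨i.2, _, hk, ?_⟩
    have hk2 := k.2
    simp only [nbhd, Finset.mem_erase, Finset.mem_Icc, Pi.le_def] at hk2
    rw [dist_pi_le_iff (by positivity)]
    intro j
    rw [Pi.add_apply, Int.dist_eq, Int.cast_add, sub_add_cancel_left, abs_neg, abs_le]
    exact ⟨by exact_mod_cast hk2.2.1 j, by exact_mod_cast hk2.2.2 j⟩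
  have hf : ∃ r : S → ℝ, r i = q ∧ extendZero S r =
      q • (lp.single 2 (i.1 : Lattice d) (1 : ℝ) -
        conv φ (lp.single 2 (i.1 : Lattice d) (1 : ℝ))) := by
    -- `r` is the `i`-th column of `q (1 - conv φ)` restricted to `S`, which loses nothing.
    choose g hg hg' using hnb
    let b : S → L2 d := fun j => lp.single 2 (j.1 : Lattice d) (1 : ℝ)
    have hb : ∀ v, extendZero S v = ∑ j, v j • b j := fun _ => rfl
    refine ⟨q • (Pi.single i 1 - ∑ k, φ k • Pi.single ⟨g k, hg k⟩ 1), ?_, ?_⟩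
    · have h0 : ∀ k, (Pi.single (⟨g k, hg k⟩ : S) (1 : ℝ) : S → ℝ) i = 0 := fun k => by
        rw [Pi.single_apply, if_neg]
        rintro rfl
        have h1 := hg' k
        have h2 := k.2
        simp only [left_eq_add] at h1
        simp [nbhd, h1] at h2
      simp [h0]
    · rw [conv_single]
      have hlin : ∀ j, extendZero S (Pi.single j 1) = b j := fun j => by
        rw [hb, Finset.sum_eq_single j]
        · simp
        · intro k _ hk
          simp [hk]
        · simp
      let L : (S → ℝ) →ₗ[ℝ] L2 d := Fintype.linearCombination ℝ b
      have hL : ∀ v, extendZero S v = L v := fun v => by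
        rw [hb, Fintype.linearCombination_apply]
      simp only [hL] at hlin ⊢
      rw [map_smul, map_sub, map_sum, hlin]
      congr 2
      refine Finset.sum_congr rfl fun k _ => ?_
      rw [map_smul, hlin]
      simp only [b, hg']
  obtain ⟨r, hri, hr⟩ := hf
  have h1 : (GamS φ S).mulVec r = Pi.single i 1 := by
    ext j
    rw [← Gam_extendZero_apply, hr, hq, lp.single_apply, Pi.single_apply, Pi.single_apply]
    simp only [Subtype.ext_iff]
  have h2 : r = (GamS φ S)⁻¹.mulVec (Pi.single i 1) := by
    rw [← h1, Matrix.mulVec_mulVec, Matrix.nonsing_inv_mul _ hdet, Matrix.one_mulVec]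
  rw [← hri, h2]
  simp

theorem trace_quadMatrix_le {φ : nbhd d h → ℝ} (hφ : φ ∈ paramSet d h) {S : Finset (Grid d m)}
    (hG : (GamS φ S).PosDef) {q : ℝ} (hq : ∀ f, Gam φ (q • (f - conv φ f)) = f) :
    (quadMatrix φ S).trace ≤ -((interior h S).card * (q - 1)) := by
  classical
  have hdet : IsUnit (GamS φ S).det := (Matrix.isUnit_iff_isUnit_det _).1 hG.isUnit
  have hsub : interior h S ⊆ S := Finset.sdiff_subset
  have h1 : (quadMatrix φ S).trace ≤ ∑ i : S, if i.1 ∈ interior h S then -(q - 1) else 0 := by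
    rw [Matrix.trace]
    refine Finset.sum_le_sum fun i _ => ?_
    rw [Matrix.diag_apply, quadMatrix, Matrix.sub_apply, Matrix.one_apply_eq]
    split_ifs with hi
    · rw [inv_GamS_diag_of_mem_interior hdet hq i hi]
      linarith
    · linarith [one_le_inv_diag hG (GamS_diag hφ S i)]
  refine h1.trans (le_of_eq ?_)
  rw [Finset.sum_coe_sort S fun i => if i ∈ interior h S then -(q - 1) else 0,
    ← Finset.sum_filter, Finset.filter_mem_eq_inter, Finset.inter_eq_right.2 hsub,
    Finset.sum_const, nsmul_eq_mul, mul_neg]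

theorem sum_sq_GamS_sub_one_le {φ : nbhd d h → ℝ} (hφ : φ ∈ paramSet d h)
    (S : Finset (Grid d m)) {q r : ℝ}
    (hr : ∀ j, ‖Gam φ (lp.single 2 j (1 : ℝ)) - q • lp.single 2 j (1 : ℝ)‖ ≤ r) :
    ∑ i, ∑ j, (GamS φ S - 1) i j ^ 2 ≤ S.card * r ^ 2 := by
  rw [Finset.sum_comm]
  have h1 : ∀ j : S, ∑ i, (GamS φ S - 1) i j ^ 2 ≤ r ^ 2 := by
    intro j
    set f : L2 d := Gam φ (lp.single 2 (j.1 : Lattice d) (1 : ℝ)) -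
      q • lp.single 2 (j.1 : Lattice d) (1 : ℝ) with hf
    have h2 : ∀ i : S, (GamS φ S - 1) i j ^ 2 ≤ f (i.1 : Lattice d) ^ 2 := by
      intro i
      -- Unit variance makes the left side vanish on the diagonal, whatever `q` is.
      by_cases hij : i = j
      · subst hij
        rw [Matrix.sub_apply, GamS_diag hφ, Matrix.one_apply_eq, sub_self]
        simpa using sq_nonneg (f (i.1 : Lattice d))
      · have h3 : f (i.1 : Lattice d) = GamS φ S i j := by
          have h4 : f (i.1 : Lattice d) = GamS φ S i j -
            q * (lp.single 2 (j.1 : Lattice d) (1 : ℝ) : L2 d) (i.1 : Lattice d) := rfl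
          rw [h4, lp.single_apply, Pi.single_apply, if_neg, mul_zero, sub_zero]
          exact fun h5 => hij (Subtype.ext (Subtype.ext h5))
        rw [h3, Matrix.sub_apply, Matrix.one_apply_ne hij, sub_zero]
    have h5 := lp.sum_rpow_le_norm_rpow (p := 2) (by norm_num) f
      (S.map (Function.Embedding.subtype _))
    simp only [ENNReal.toReal_ofNat, Real.rpow_two, Real.norm_eq_abs, sq_abs, Finset.sum_map,
      Function.Embedding.subtype_apply] at h5
    calc ∑ i, (GamS φ S - 1) i j ^ 2 ≤ ∑ i : S, f (i.1 : Lattice d) ^ 2 :=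
          Finset.sum_le_sum fun i _ => h2 i
      _ = ∑ i ∈ S, f (i : Lattice d) ^ 2 := Finset.sum_coe_sort S fun i => f (i : Lattice d) ^ 2
      _ ≤ ‖f‖ ^ 2 := h5
      _ ≤ r ^ 2 := pow_le_pow_left₀ (norm_nonneg _) (hr _) 2
  refine (Finset.sum_le_sum fun j _ => h1 j).trans (le_of_eq ?_)
  simp

end Submatrix

/-! ### Norms of the quadratic form -/

section Norms

variable {ι : Type} [Fintype ι]

theorem frobNorm_nonneg (A : Matrix ι ι ℝ) : 0 ≤ frobNorm A := Real.sqrt_nonneg _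

theorem frobNorm_sq (A : Matrix ι ι ℝ) : frobNorm A ^ 2 = ∑ i, ∑ j, A i j ^ 2 :=
  Real.sq_sqrt (Finset.sum_nonneg fun _ _ => Finset.sum_nonneg fun _ _ => sq_nonneg _)

theorem trace_mul_self_eq_frobNorm_sq {A : Matrix ι ι ℝ} (hA : A.IsHermitian) :
    (A * A).trace = frobNorm A ^ 2 := by
  rw [frobNorm_sq]
  refine Finset.sum_congr rfl fun i _ => Finset.sum_congr rfl fun j _ => ?_
  have h1 := hA.apply j i
  rw [star_trivial] at h1
  change A i j * A j i = A i j ^ 2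
  rw [h1, sq]

theorem frobNorm_eq_zero {A : Matrix ι ι ℝ} (hA : frobNorm A = 0) : A = 0 := by
  have h1 := frobNorm_sq A
  rw [hA, zero_pow two_ne_zero, eq_comm] at h1
  ext i j
  have h2 := (Finset.sum_eq_zero_iff_of_nonneg
    fun i _ => Finset.sum_nonneg fun j _ => sq_nonneg (A i j)).1 h1 i (Finset.mem_univ i)
  have h3 := (Finset.sum_eq_zero_iff_of_nonneg
    fun j _ => sq_nonneg (A i j)).1 h2 j (Finset.mem_univ j)
  simpa using h3

variable [DecidableEq ι]

theorem opNorm_nonneg (A : Matrix ι ι ℝ) : 0 ≤ opNorm A := norm_nonneg _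

theorem abs_dotProduct_mulVec_le (A : Matrix ι ι ℝ) (v : ι → ℝ) :
    |v ⬝ᵥ A.mulVec v| ≤ opNorm A * (v ⬝ᵥ v) := by
  have h1 := Matrix.inner_toEuclideanCLM A (WithLp.toLp 2 v) (WithLp.toLp 2 v)
  have h2 : ‖WithLp.toLp 2 v‖ ^ 2 = v ⬝ᵥ v := by
    rw [EuclideanSpace.real_norm_sq_eq]
    exact Finset.sum_congr rfl fun i _ => sq _
  simp only at h1
  rw [← h1, ← h2]
  refine (abs_real_inner_le_norm _ _).trans ?_
  have h3 := (Matrix.toEuclideanCLM (𝕜 := ℝ) A).le_opNorm (WithLp.toLp 2 v)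
  rw [opNorm]
  nlinarith [norm_nonneg (WithLp.toLp 2 v)]

theorem dotProduct_self_inv_mulVec_le {G : Matrix ι ι ℝ} (hdet : IsUnit G.det) {c : ℝ}
    (hc : 0 < c) (hG : ∀ v : ι → ℝ, c * (v ⬝ᵥ v) ≤ v ⬝ᵥ G.mulVec v) (v : ι → ℝ) :
    G⁻¹.mulVec v ⬝ᵥ G⁻¹.mulVec v ≤ c⁻¹ ^ 2 * (v ⬝ᵥ v) := by
  set u := G⁻¹.mulVec v with hu
  have h1 : G.mulVec u = v := by
    rw [hu, Matrix.mulVec_mulVec, Matrix.mul_nonsing_inv _ hdet, Matrix.one_mulVec]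
  have h2 := hG u
  rw [h1] at h2
  have h3 : 0 ≤ (c • u - v) ⬝ᵥ (c • u - v) :=
    Finset.sum_nonneg fun i _ => mul_self_nonneg _
  simp only [sub_dotProduct, dotProduct_sub, smul_dotProduct, dotProduct_smul, smul_eq_mul,
    dotProduct_comm v u] at h3
  rw [inv_pow, inv_mul_eq_div, le_div_iff₀ (by positivity)]
  nlinarith

theorem opNorm_inv_le {G : Matrix ι ι ℝ} (hdet : IsUnit G.det) {c : ℝ}
    (hc : 0 < c) (hG : ∀ v : ι → ℝ, c * (v ⬝ᵥ v) ≤ v ⬝ᵥ G.mulVec v) : opNorm G⁻¹ ≤ c⁻¹ := by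
  refine ContinuousLinearMap.opNorm_le_bound _ (inv_nonneg.2 hc.le) fun x => ?_
  refine abs_le_of_sq_le_sq' ?_ (by positivity) |>.2
  rw [mul_pow, EuclideanSpace.real_norm_sq_eq, EuclideanSpace.real_norm_sq_eq]
  have h1 := dotProduct_self_inv_mulVec_le hdet hc hG x.ofLp
  simp only [dotProduct, ← sq] at h1
  exact h1

theorem opNorm_one_sub_inv_le {G : Matrix ι ι ℝ} (hdet : IsUnit G.det) {c : ℝ}
    (hc : 0 < c) (hG : ∀ v : ι → ℝ, c * (v ⬝ᵥ v) ≤ v ⬝ᵥ G.mulVec v) :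
    opNorm (1 - G⁻¹) ≤ 1 + c⁻¹ := by
  rw [opNorm, map_sub, map_one]
  refine (norm_sub_le _ _).trans (add_le_add ?_ (opNorm_inv_le hdet hc hG))
  exact ContinuousLinearMap.norm_id_le

theorem frobNorm_one_sub_inv_sq_le {G : Matrix ι ι ℝ} (hdet : IsUnit G.det) {c : ℝ}
    (hc : 0 < c) (hG : ∀ v : ι → ℝ, c * (v ⬝ᵥ v) ≤ v ⬝ᵥ G.mulVec v) :
    frobNorm (1 - G⁻¹) ^ 2 ≤ c⁻¹ ^ 2 * frobNorm (G - 1) ^ 2 := by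
  have h1 : 1 - G⁻¹ = G⁻¹ * (G - 1) := by
    rw [mul_sub, Matrix.nonsing_inv_mul _ hdet, mul_one]
  rw [frobNorm_sq, frobNorm_sq, Finset.sum_comm, Finset.sum_comm (γ := ι) (f := fun i j =>
    (G - 1) i j ^ 2), Finset.mul_sum]
  refine Finset.sum_le_sum fun j _ => ?_
  have h2 := dotProduct_self_inv_mulVec_le hdet hc hG fun i => (G - 1) i j
  simp only [dotProduct, ← sq] at h2
  rw [h1]
  exact h2

end Norms

/-! ### Tail bounds under the null and the alternative -/

section Tails

theorem stdGaussian_quadForm_comp_tail {ι κ : Type*} [Fintype ι] [DecidableEq ι] [Fintype κ]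
    {A : Matrix κ κ ℝ} (hA : A.IsHermitian) (W : Matrix κ ι ℝ) {F b t : ℝ} (hF : 0 ≤ F)
    (hb : 0 ≤ b) (ht : 0 ≤ t)
    (hAF : (A * (W * W.transpose) * (A * (W * W.transpose))).trace ≤ F ^ 2)
    (hAb : ∀ v : ι → ℝ, |W.mulVec v ⬝ᵥ A.mulVec (W.mulVec v)| ≤ b * (v ⬝ᵥ v)) :
    (stdGaussian (EuclideanSpace ℝ ι)).real
      {z | 2 * F * Real.sqrt t + 2 * b * t <
        W.mulVec z.ofLp ⬝ᵥ A.mulVec (W.mulVec z.ofLp) - (A * (W * W.transpose)).trace} ≤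
      Real.exp (-t) := by
  have hquad : ∀ v : ι → ℝ, v ⬝ᵥ (W.transpose * A * W).mulVec v =
      W.mulVec v ⬝ᵥ A.mulVec (W.mulVec v) := fun v => by
    rw [← Matrix.mulVec_mulVec, ← Matrix.mulVec_mulVec, Matrix.dotProduct_mulVec,
      Matrix.vecMul_transpose]
  have htr : (W.transpose * A * W).trace = (A * (W * W.transpose)).trace := by
    rw [Matrix.mul_assoc, Matrix.trace_mul_comm, Matrix.mul_assoc]
  have hherm : (W.transpose * A * W).IsHermitian := by
    have := Matrix.isHermitian_conjTranspose_mul_mul W hA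
    rwa [Matrix.conjTranspose_eq_transpose_of_trivial] at this
  have htr2 : (W.transpose * A * W * (W.transpose * A * W)).trace =
      (A * (W * W.transpose) * (A * (W * W.transpose))).trace := by
    rw [Matrix.mul_assoc W.transpose, Matrix.mul_assoc W.transpose, Matrix.trace_mul_comm]
    simp only [Matrix.mul_assoc]
  have h1 := stdGaussian_quadForm_tail hherm hF hb ht (htr2.trans_le hAF)
    (fun v => by rw [hquad]; exact hAb v)
  simp only [hquad, htr] at h1
  exact h1

variable {d h m : ℕ}

/-- The matrix of the restriction map `x ↦ x_S`. -/
def restrMatrix (S : Finset (Grid d m)) : Matrix S (Grid d m) ℝ :=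
  (1 : Matrix (Grid d m) (Grid d m) ℝ).submatrix Subtype.val id

theorem restrMatrix_mulVec (S : Finset (Grid d m)) (v : Grid d m → ℝ) :
    (restrMatrix S).mulVec v = fun i => v i.1 := by
  ext i
  simp [restrMatrix, Matrix.mulVec, dotProduct, Matrix.one_apply]

theorem restrMatrix_mul_mul_transpose (S : Finset (Grid d m))
    (M : Matrix (Grid d m) (Grid d m) ℝ) :
    restrMatrix S * M * (restrMatrix S).transpose = M.submatrix Subtype.val Subtype.val := by
  ext i j
  simp [restrMatrix, Matrix.mul_apply, Matrix.one_apply]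

theorem dotProduct_self_eq_restr_add (S : Finset (Grid d m)) (v : Grid d m → ℝ) :
    v ⬝ᵥ v = (restrMatrix S).mulVec v ⬝ᵥ (restrMatrix S).mulVec v +
      ∑ i, if i ∈ S then 0 else v i ^ 2 := by
  rw [restrMatrix_mulVec]
  simp only [dotProduct]
  rw [Finset.sum_coe_sort S fun i => v i * v i, ← Finset.sum_filter_add_sum_filter_not
    Finset.univ (· ∈ S) fun i => v i * v i, Finset.filter_univ_mem, Finset.sum_filter]
  congr 1
  exact Finset.sum_congr rfl fun i _ => by split_ifs <;> simp_all [sq]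

theorem restrMatrix_dotProduct_le (S : Finset (Grid d m)) (v : Grid d m → ℝ) :
    (restrMatrix S).mulVec v ⬝ᵥ (restrMatrix S).mulVec v ≤ v ⬝ᵥ v := by
  rw [dotProduct_self_eq_restr_add S v]
  refine le_add_of_nonneg_right (Finset.sum_nonneg fun i _ => ?_)
  split_ifs
  · exact le_rfl
  · exact sq_nonneg _

theorem dotProduct_altCov_mulVec (φ : nbhd d h → ℝ) (S : Finset (Grid d m))
    (v : Grid d m → ℝ) :
    v ⬝ᵥ (altCov φ S).mulVec v =
      (restrMatrix S).mulVec v ⬝ᵥ (GamS φ S).mulVec ((restrMatrix S).mulVec v) +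
        ∑ i, if i ∈ S then 0 else v i ^ 2 := by
  have h1 : ∀ i, v i * (altCov φ S).mulVec v i =
      (if i ∈ S then v i * ∑ j ∈ S, entry (Gam φ) i j * v j else 0) +
        if i ∈ S then 0 else v i ^ 2 := by
    intro i
    by_cases hi : i ∈ S
    · simp only [Matrix.mulVec, dotProduct, altCov, Matrix.of_apply, hi, true_and, if_true,
        add_zero]
      congr 1
      rw [← Finset.filter_univ_mem S, Finset.sum_filter]
      refine Finset.sum_congr rfl fun j _ => ?_
      by_cases hj : j ∈ S
      · simp [hj]
      · have : i ≠ j := fun hij => hj (hij ▸ hi)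
        simp [hj, this]
    · simp [Matrix.mulVec, dotProduct, altCov, hi, sq]
  have h2 : v ⬝ᵥ (altCov φ S).mulVec v = ∑ i, v i * (altCov φ S).mulVec v i := rfl
  rw [h2, Finset.sum_congr rfl fun i _ => h1 i, Finset.sum_add_distrib, ← Finset.sum_filter,
    Finset.filter_univ_mem, restrMatrix_mulVec]
  congr 1
  rw [← Finset.sum_coe_sort S]
  refine Finset.sum_congr rfl fun i _ => ?_
  rw [← Finset.sum_coe_sort S]
  rfl

theorem isHermitian_quadMatrix {φ : nbhd d h → ℝ} (hφ : φ ∈ paramSet d h)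
    (S : Finset (Grid d m)) : (quadMatrix φ S).IsHermitian :=
  Matrix.isHermitian_one.sub (isHermitian_GamS hφ S).inv

theorem nullLaw_quadForm_tail {φ : nbhd d h → ℝ} (hφ : φ ∈ paramSet d h)
    (S : Finset (Grid d m)) {t : ℝ} (ht : 0 ≤ t) :
    (nullLaw d m).real {x | 2 * frobNorm (quadMatrix φ S) * Real.sqrt t +
      2 * opNorm (quadMatrix φ S) * t <
        restr x S ⬝ᵥ (quadMatrix φ S).mulVec (restr x S) - (quadMatrix φ S).trace} ≤
      Real.exp (-t) := by
  have hA := isHermitian_quadMatrix hφ S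
  have hW : restrMatrix S * (restrMatrix S).transpose = 1 := by
    have h1 := restrMatrix_mul_mul_transpose S 1
    rwa [Matrix.mul_one, Matrix.submatrix_one _ Subtype.val_injective] at h1
  have h1 := stdGaussian_quadForm_comp_tail hA (restrMatrix S) (frobNorm_nonneg _)
    (opNorm_nonneg _) ht
    (by rw [hW, Matrix.mul_one, trace_mul_self_eq_frobNorm_sq hA])
    (fun v => (abs_dotProduct_mulVec_le _ _).trans
      (mul_le_mul_of_nonneg_left (restrMatrix_dotProduct_le S v) (opNorm_nonneg _)))
  simp only [hW, Matrix.mul_one, restrMatrix_mulVec] at h1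
  exact h1

open scoped MatrixOrder in
/-- Under the alternative, `x_S = W z` with `z` standard normal and `W Wᵀ = Γ_S`, so that
`x_Sᵀ (I - Γ_S⁻¹) x_S` is centered and its Frobenius norm is that of `Γ_S - I`. -/
theorem altLaw_quadForm_tail {φ : nbhd d h → ℝ} (hφ : φ ∈ paramSet d h) (S : Finset (Grid d m))
    (hG : (GamS φ S).PosDef) {u : ℝ} (hu : 1 ≤ u)
    (hup : ∀ v, v ⬝ᵥ (GamS φ S).mulVec v ≤ u * (v ⬝ᵥ v)) {t : ℝ} (ht : 0 ≤ t) :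
    (altLaw φ S).real {x | 2 * frobNorm (GamS φ S - 1) * Real.sqrt t +
      2 * (u * opNorm (quadMatrix φ S)) * t <
        -(restr x S ⬝ᵥ (quadMatrix φ S).mulVec (restr x S))} ≤ Real.exp (-t) := by
  have hdet : IsUnit (GamS φ S).det := (Matrix.isUnit_iff_isUnit_det _).1 hG.isUnit
  have hQ := isHermitian_quadMatrix hφ S
  have hcov : (altCov φ S).PosSemidef := by
    refine Matrix.PosSemidef.of_dotProduct_mulVec_nonneg ?_ fun v => ?_
    · ext i j
      have h1 : entry (Gam φ) j i = entry (Gam φ) i j := by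
        rw [entry_eq_inner, entry_eq_inner, real_inner_comm]
        exact (isGMRFCovariance_Gam hφ).isPositive.isSymmetric _ _
      simp only [Matrix.conjTranspose_apply, star_trivial, altCov, Matrix.of_apply, h1,
        and_comm, eq_comm]
    · rw [star_trivial, dotProduct_altCov_mulVec]
      refine add_nonneg ?_ (Finset.sum_nonneg fun i _ => ?_)
      · simpa using hG.posSemidef.dotProduct_mulVec_nonneg ((restrMatrix S).mulVec v)
      · split_ifs
        · exact le_rfl
        · exact sq_nonneg _
  set R := CFC.sqrt (altCov φ S) with hR
  have hRR : R * R = altCov φ S := CFC.sqrt_mul_sqrt_self _ hcov.nonneg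
  have hRT : R.transpose = R := by
    have h1 : R.PosSemidef := Matrix.nonneg_iff_posSemidef.1 (CFC.sqrt_nonneg _)
    simpa using h1.isHermitian.eq
  set W := restrMatrix S * R with hWdef
  have hW : W * W.transpose = GamS φ S := by
    rw [hWdef, Matrix.transpose_mul, hRT, Matrix.mul_assoc, ← Matrix.mul_assoc R, hRR,
      ← Matrix.mul_assoc, restrMatrix_mul_mul_transpose]
    ext i j
    simp [altCov, GamS]
  have hQG : -quadMatrix φ S * GamS φ S = -(GamS φ S - 1) := by
    rw [quadMatrix, neg_mul, sub_mul, one_mul, Matrix.nonsing_inv_mul _ hdet]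
  have htr : (-quadMatrix φ S * GamS φ S).trace = 0 := by
    rw [hQG, Matrix.trace_neg, neg_eq_zero]
    refine Finset.sum_eq_zero fun i _ => ?_
    rw [Matrix.diag_apply, Matrix.sub_apply, GamS_diag hφ, Matrix.one_apply_eq, sub_self]
  have hquad : ∀ v : Grid d m → ℝ, R.mulVec v ⬝ᵥ R.mulVec v ≤ u * (v ⬝ᵥ v) := fun v => by
    have h1 : R.mulVec v ⬝ᵥ R.mulVec v = v ⬝ᵥ (altCov φ S).mulVec v := by
      rw [← hRR, ← Matrix.mulVec_mulVec, Matrix.dotProduct_mulVec v, ← Matrix.mulVec_transpose,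
        hRT]
    have h2 : (0 : ℝ) ≤ ∑ i, if i ∈ S then 0 else v i ^ 2 := Finset.sum_nonneg fun i _ => by
      split_ifs
      · exact le_rfl
      · exact sq_nonneg _
    rw [h1, dotProduct_altCov_mulVec, dotProduct_self_eq_restr_add S v, mul_add]
    exact add_le_add (hup _) (le_mul_of_one_le_left h2 hu)
  have h1 := stdGaussian_quadForm_comp_tail hQ.neg W (F := frobNorm (GamS φ S - 1))
    (b := u * opNorm (quadMatrix φ S)) (frobNorm_nonneg _)
    (mul_nonneg (zero_le_one.trans hu) (opNorm_nonneg _)) ht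
    (by
      rw [hW, hQG, neg_mul_neg, trace_mul_self_eq_frobNorm_sq
        ((isHermitian_GamS hφ S).sub Matrix.isHermitian_one)])
    (fun v => by
      rw [Matrix.neg_mulVec, dotProduct_neg, abs_neg]
      refine (abs_dotProduct_mulVec_le _ _).trans ?_
      rw [mul_comm u, mul_assoc]
      refine mul_le_mul_of_nonneg_left ?_ (opNorm_nonneg _)
      rw [hWdef, ← Matrix.mulVec_mulVec]
      exact (restrMatrix_dotProduct_le S _).trans (hquad v))
  simp only [hW, htr, sub_zero, Matrix.neg_mulVec, dotProduct_neg] at h1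
  rw [altLaw, multivariateGaussian, map_measureReal_apply (by fun_prop)]
  · refine le_trans (le_of_eq ?_) h1
    congr 1
    ext z
    have h2 : restr (0 + Matrix.toEuclideanCLM (𝕜 := ℝ) R z) S = W.mulVec z.ofLp := by
      rw [zero_add, hWdef, ← Matrix.mulVec_mulVec, restrMatrix_mulVec]
      rfl
    simp only [Set.mem_preimage, Set.mem_ofPred_eq]
    rw [h2]
  · refine measurableSet_lt measurable_const ?_
    simp only [dotProduct, Matrix.mulVec, restr]
    fun_prop

end Tails

/-! ### The test -/

section Test

variable {d h m : ℕ}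

theorem measurable_glrTest (𝒞 : Finset (Finset (Grid d m))) (hne : 𝒞.Nonempty)
    (φ : nbhd d h → ℝ) : Measurable (glrTest 𝒞 hne φ) := by
  have hU : Measurable (statU 𝒞 hne φ) := by
    have h1 : statU 𝒞 hne φ = 𝒞.sup' hne fun S x =>
        (restr x S ⬝ᵥ (quadMatrix φ S).mulVec (restr x S) - (quadMatrix φ S).trace) /
          (frobNorm (quadMatrix φ S) * Real.sqrt (Real.log 𝒞.card) +
            opNorm (quadMatrix φ S) * Real.log 𝒞.card) := by
      ext x
      rw [Finset.sup'_apply]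
      rfl
    rw [h1]
    refine Finset.measurable_sup' hne fun S _ => ?_
    simp only [dotProduct, Matrix.mulVec, restr]
    fun_prop
  refine measurable_to_bool ?_
  have h2 : glrTest 𝒞 hne φ ⁻¹' {true} = {x | 4 < statU 𝒞 hne φ x} := by
    ext x
    simp [glrTest]
  rw [h2]
  exact measurableSet_lt measurable_const hU

theorem exp_neg_log_card {α : Type*} {s : Finset α} (hs : s.Nonempty) :
    Real.exp (-Real.log s.card) = 1 / s.card := by
  rw [Real.exp_neg, Real.exp_log (by exact_mod_cast hs.card_pos), one_div]

/-- Each quadratic form exceeds its threshold with probability at most `|𝒞|⁻²`: the constant `4`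
dominates the tail bound at `t = 2 log |𝒞|`. -/
theorem nullLaw_glrTest_le {φ : nbhd d h → ℝ} (hφ : φ ∈ paramSet d h)
    (𝒞 : Finset (Finset (Grid d m))) (hne : 𝒞.Nonempty) :
    (nullLaw d m).real {x | glrTest 𝒞 hne φ x = true} ≤ 1 / 𝒞.card := by
  have hcard : (1 : ℝ) ≤ 𝒞.card := by exact_mod_cast hne.card_pos
  set L := Real.log 𝒞.card with hLdef
  have hL : 0 ≤ L := Real.log_nonneg hcard
  have hsub : {x | glrTest 𝒞 hne φ x = true} ⊆ ⋃ S ∈ 𝒞,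
      {x | 2 * frobNorm (quadMatrix φ S) * Real.sqrt (2 * L) +
        2 * opNorm (quadMatrix φ S) * (2 * L) <
        restr x S ⬝ᵥ (quadMatrix φ S).mulVec (restr x S) - (quadMatrix φ S).trace} := by
    intro x hx
    have hx' : 4 < statU 𝒞 hne φ x := by simpa [glrTest] using hx
    obtain ⟨S, hS, hlt⟩ := (Finset.lt_sup'_iff hne).1 hx'
    refine Set.mem_biUnion hS ?_
    have hden : 0 ≤ frobNorm (quadMatrix φ S) * Real.sqrt L + opNorm (quadMatrix φ S) * L :=
      add_nonneg (mul_nonneg (frobNorm_nonneg _) (Real.sqrt_nonneg _))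
        (mul_nonneg (opNorm_nonneg _) hL)
    -- A vanishing denominator makes the fraction `0`, which does not exceed `4`.
    have hden' : 0 < frobNorm (quadMatrix φ S) * Real.sqrt L + opNorm (quadMatrix φ S) * L := by
      refine lt_of_le_of_ne hden fun h0 => ?_
      rw [← h0, div_zero] at hlt
      linarith
    rw [lt_div_iff₀ hden'] at hlt
    have hsqrt : Real.sqrt (2 * L) ≤ 2 * Real.sqrt L := by
      rw [Real.sqrt_le_left (by positivity), mul_pow, Real.sq_sqrt hL]
      linarith
    have := mul_le_mul_of_nonneg_left hsqrt (frobNorm_nonneg (quadMatrix φ S))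
    simp only [Set.mem_ofPred_eq]
    linarith
  have : IsProbabilityMeasure (nullLaw d m) := by unfold nullLaw; infer_instance
  refine (measureReal_mono hsub (measure_ne_top _ _)).trans
    ((measureReal_biUnion_finset_le _ _).trans ?_)
  refine (Finset.sum_le_sum fun S _ => nullLaw_quadForm_tail hφ S (by linarith)).trans ?_
  have h1 : Real.exp (-(2 * L)) = 1 / 𝒞.card * (1 / 𝒞.card) := by
    rw [← exp_neg_log_card hne, ← Real.exp_add, ← hLdef]
    ring_nf
  rw [Finset.sum_const, nsmul_eq_mul, h1]
  field_simp
  exact le_rfl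

/-- If the mean of the statistic exceeds its threshold by more than the fluctuations under the
alternative, the type II error at `S` is at most `|𝒞|⁻¹`. -/
theorem altLaw_glrTest_le {φ : nbhd d h → ℝ} (hφ : φ ∈ paramSet d h)
    (𝒞 : Finset (Finset (Grid d m))) (hne : 𝒞.Nonempty) {S : Finset (Grid d m)} (hS : S ∈ 𝒞)
    (hL : 0 < Real.log 𝒞.card) (hG : (GamS φ S).PosDef) {u : ℝ} (hu : 1 ≤ u)
    (hup : ∀ v, v ⬝ᵥ (GamS φ S).mulVec v ≤ u * (v ⬝ᵥ v))
    (hsep : 4 * (frobNorm (quadMatrix φ S) * Real.sqrt (Real.log 𝒞.card) +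
        opNorm (quadMatrix φ S) * Real.log 𝒞.card) +
      (2 * frobNorm (GamS φ S - 1) * Real.sqrt (Real.log 𝒞.card) +
        2 * (u * opNorm (quadMatrix φ S)) * Real.log 𝒞.card) < -(quadMatrix φ S).trace) :
    (altLaw φ S).real {x | glrTest 𝒞 hne φ x = false} ≤ 1 / 𝒞.card := by
  rw [← exp_neg_log_card hne]
  set L := Real.log 𝒞.card with hLdef
  have : IsProbabilityMeasure (altLaw φ S) := by unfold altLaw; infer_instance
  refine (measureReal_mono (fun x hx => ?_) (measure_ne_top _ _)).trans
    (altLaw_quadForm_tail hφ S hG hu hup hL.le)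
  have hx' : statU 𝒞 hne φ x ≤ 4 := by simpa [glrTest] using hx
  have h1 := (Finset.sup'_le_iff hne _).1 hx' S hS
  have hF := frobNorm_nonneg (quadMatrix φ S)
  have hO := opNorm_nonneg (quadMatrix φ S)
  have hF' := frobNorm_nonneg (GamS φ S - 1)
  have hsL : 0 < Real.sqrt L := Real.sqrt_pos.2 hL
  have hu0 : 0 ≤ u := zero_le_one.trans hu
  have htr : 0 < -(quadMatrix φ S).trace := lt_of_le_of_lt (by positivity) hsep
  have hF0 : 0 < frobNorm (quadMatrix φ S) := by
    refine lt_of_le_of_ne hF fun h0 => ?_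
    rw [frobNorm_eq_zero h0.symm, Matrix.trace_zero, neg_zero] at htr
    exact lt_irrefl _ htr
  rw [div_le_iff₀ (by positivity)] at h1
  simp only [Set.mem_ofPred_eq]
  linarith

/-- The numerical comparison behind the choice of `C₀`: each noise term is at most a multiple of
`N / M`, where `N` is proportional to the signal. -/
theorem noise_lt_signal {a k p N L M F O F' : ℝ} (hk : 0 ≤ k) (hp : 0 ≤ p)
    (hM : 8 * (4 * (p * k + (1 + p)) + 2 * k + 2 * (k * (1 + p))) < a * M) (hM1 : 1 ≤ M)
    (hL : 0 < L) (hN : M ^ 2 * L ≤ N)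
    (hF : F ^ 2 ≤ p ^ 2 * (k ^ 2 * N)) (hO : O ≤ 1 + p) (hF' : F' ^ 2 ≤ k ^ 2 * N) :
    4 * (F * Real.sqrt L + O * L) + (2 * F' * Real.sqrt L + 2 * (k * O) * L) < a * N / 8 := by
  have hM0 : 0 < M := by linarith
  have hN0 : 0 < N := lt_of_lt_of_le (by positivity) hN
  set r := Real.sqrt N
  set s := Real.sqrt L
  have hr : 0 ≤ r := Real.sqrt_nonneg N
  have hs : 0 ≤ s := Real.sqrt_nonneg L
  have hr2 : r ^ 2 = N := Real.sq_sqrt hN0.le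
  have hs2 : s ^ 2 = L := Real.sq_sqrt hL.le
  have h1 : F ≤ p * (k * r) := by
    refine abs_le_of_sq_le_sq' ?_ (by positivity) |>.2
    rw [mul_pow, mul_pow, hr2]
    exact hF
  have h2 : F' ≤ k * r := by
    refine abs_le_of_sq_le_sq' ?_ (by positivity) |>.2
    rw [mul_pow, hr2]
    exact hF'
  have h3 : s * M ≤ r := by
    refine abs_le_of_sq_le_sq' ?_ hr |>.2
    rw [mul_pow, hr2, hs2, mul_comm]
    exact hN
  have hsr : r * s * M ≤ N := by nlinarith
  have hLM : L * M ≤ N := by nlinarith [mul_pos hL hM0]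
  have e1 : F * s * M ≤ p * k * N := by
    calc F * s * M ≤ p * (k * r) * s * M := by gcongr
      _ = p * k * (r * s * M) := by ring
      _ ≤ p * k * N := mul_le_mul_of_nonneg_left hsr (by positivity)
  have e2 : F' * s * M ≤ k * N := by
    calc F' * s * M ≤ k * r * s * M := by gcongr
      _ = k * (r * s * M) := by ring
      _ ≤ k * N := mul_le_mul_of_nonneg_left hsr hk
  have e3 : O * L * M ≤ (1 + p) * N := by
    calc O * L * M ≤ (1 + p) * L * M := by gcongr
      _ = (1 + p) * (L * M) := by ring
      _ ≤ (1 + p) * N := mul_le_mul_of_nonneg_left hLM (by positivity)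
  have e4 : k * (O * L * M) ≤ k * ((1 + p) * N) := mul_le_mul_of_nonneg_left e3 hk
  have e5 := mul_lt_mul_of_pos_right hM hN0
  refine lt_of_mul_lt_mul_right ?_ hM0.le
  nlinarith

/-- Here `p` bounds the operator norm of `Γ_S⁻¹` and `k` that of `Γ_S`. -/
theorem altLaw_glrTest_le_of_l1Norm_le {η : ℝ} (hη : η < 1) {φ : nbhd d h → ℝ}
    (hφ : φ ∈ paramSet d h) (h1 : l1Norm φ ≤ η) (𝒞 : Finset (Finset (Grid d m)))
    (hne : 𝒞.Nonempty) {S : Finset (Grid d m)} (hS : S ∈ 𝒞) (hL : 0 < Real.log 𝒞.card)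
    (hint : (S.card : ℝ) / 2 ≤ (interior h S).card) {p k M : ℝ} (hp : p = ((1 - η) ^ 2 / 4)⁻¹)
    (hk : k = (1 - η)⁻¹)
    (hM : 8 * (4 * (p * k + (1 + p)) + 2 * k + 2 * (k * (1 + p))) < (1 - η) * M) (hM1 : 1 ≤ M)
    (hN : M ^ 2 * Real.log 𝒞.card ≤ l2Norm φ ^ 2 * S.card) :
    (altLaw φ S).real {x | glrTest 𝒞 hne φ x = false} ≤ 1 / 𝒞.card := by
  have hη0 : 0 ≤ η := (Finset.sum_nonneg fun i _ => abs_nonneg (φ i)).trans h1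
  have ha : 0 < 1 - η := by linarith
  have hk1 : 1 ≤ k := by
    rw [hk]
    exact (one_le_inv₀ ha).2 (by linarith)
  have hc : 0 < (1 - η) ^ 2 / 4 := by positivity
  have hp0 : 0 ≤ p := by rw [hp]; positivity
  obtain ⟨q, hq, hinv, hnorm, hlow, hcol⟩ := exists_scale_bounds hφ hη h1
  rw [← hk] at hnorm hcol
  have hG : (GamS φ S).PosDef := posDef_GamS hφ hc hlow
  have hdet : IsUnit (GamS φ S).det := (Matrix.isUnit_iff_isUnit_det _).1 hG.isUnit
  have hGlow : ∀ v, (1 - η) ^ 2 / 4 * (v ⬝ᵥ v) ≤ v ⬝ᵥ (GamS φ S).mulVec v := fun v => by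
    rw [dotProduct_GamS_mulVec, ← norm_extendZero_sq]
    exact hlow _
  have hGup : ∀ v, v ⬝ᵥ (GamS φ S).mulVec v ≤ k * (v ⬝ᵥ v) := fun v => by
    rw [dotProduct_GamS_mulVec, ← norm_extendZero_sq]
    refine (real_inner_le_norm _ _).trans ?_
    nlinarith [hnorm (extendZero S v), norm_nonneg (extendZero S v)]
  have hF' : frobNorm (GamS φ S - 1) ^ 2 ≤ k ^ 2 * (l2Norm φ ^ 2 * S.card) := by
    rw [frobNorm_sq]
    refine (sum_sq_GamS_sub_one_le hφ S hcol).trans (le_of_eq ?_)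
    ring
  have hF : frobNorm (quadMatrix φ S) ^ 2 ≤ p ^ 2 * (k ^ 2 * (l2Norm φ ^ 2 * S.card)) := by
    refine (frobNorm_one_sub_inv_sq_le hdet hc hGlow).trans ?_
    rw [← hp]
    exact mul_le_mul_of_nonneg_left hF' (sq_nonneg _)
  have hO : opNorm (quadMatrix φ S) ≤ 1 + p := by
    rw [hp]
    exact opNorm_one_sub_inv_le hdet hc hGlow
  refine altLaw_glrTest_le hφ 𝒞 hne hS hL hG hk1 hGup ?_
  refine (noise_lt_signal (by linarith) hp0 hM hM1 hL hN hF hO hF').trans_le ?_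
  have htr := trace_quadMatrix_le hφ hG hinv
  have hq1 : (1 - η) / 4 * l2Norm φ ^ 2 ≤ q - 1 := by linarith
  have h2 : (S.card : ℝ) / 2 * ((1 - η) / 4 * l2Norm φ ^ 2) ≤
      (interior h S).card * (q - 1) :=
    mul_le_mul hint hq1 (by positivity) (by positivity)
  linarith

end Test

end HiddenGMRF

end

theorem mainTheorem6 (d : ℕ) (hd : 1 ≤ d) (η : ℝ) (hη : η < 1) :
    ∃ C₀ : ℝ, 0 < C₀ ∧
      ∀ (h m : ℕ) (_ : 1 ≤ h) (φ : HiddenGMRF.nbhd d h → ℝ)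
        (𝒞 : Finset (Finset (HiddenGMRF.Grid d m))) (hne : 𝒞.Nonempty),
        φ ∈ HiddenGMRF.paramSet d h →
        HiddenGMRF.l1Norm φ ≤ η →
        (∀ S ∈ 𝒞, (S.card : ℝ) / 2 ≤ (HiddenGMRF.interior h S).card) →
        C₀ * Real.log 𝒞.card ≤
          HiddenGMRF.l2Norm φ ^ 2 * (𝒞.inf' hne Finset.card : ℕ) →
        Measurable (HiddenGMRF.glrTest 𝒞 hne φ) ∧
        HiddenGMRF.risk 𝒞 hne φ (HiddenGMRF.glrTest 𝒞 hne φ) ≤ 2 / 𝒞.card := by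
  have ha : 0 < 1 - η := by linarith
  obtain ⟨p, hp⟩ : ∃ p, p = ((1 - η) ^ 2 / 4)⁻¹ := ⟨_, rfl⟩
  obtain ⟨k, hk⟩ : ∃ k, k = (1 - η)⁻¹ := ⟨_, rfl⟩
  have hp0 : 0 < p := by rw [hp]; positivity
  have hk0 : 0 < k := by rw [hk]; positivity
  obtain ⟨K, hK⟩ : ∃ K, K = 8 * (4 * (p * k + (1 + p)) + 2 * k + 2 * (k * (1 + p))) := ⟨_, rfl⟩
  have hK0 : 0 < K := by rw [hK]; positivity
  -- The square root of `C₀` is chosen so that the noise constant `K` is less than `(1 - η) M`.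
  obtain ⟨M, hMdef⟩ : ∃ M, M = 1 + K / (1 - η) := ⟨_, rfl⟩
  have hM1 : 1 ≤ M := by
    rw [hMdef]
    exact le_add_of_nonneg_right (by positivity)
  have hM : K < (1 - η) * M := by
    rw [hMdef, mul_add, mul_div_cancel₀ _ ha.ne']
    linarith
  refine ⟨M ^ 2, by positivity, fun h m _ φ 𝒞 hne hφ h1 hint hN =>
    ⟨HiddenGMRF.measurable_glrTest 𝒞 hne φ, ?_⟩⟩
  have hnull := HiddenGMRF.nullLaw_glrTest_le hφ 𝒞 hne
  have halt : ∀ S ∈ 𝒞, (HiddenGMRF.altLaw φ S).real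
      {x | HiddenGMRF.glrTest 𝒞 hne φ x = false} ≤ 1 / 𝒞.card := by
    intro S hS
    rcases (Nat.one_le_iff_ne_zero.2 hne.card_pos.ne').eq_or_lt with hc | hc
    · -- A class with a single element leaves nothing to prove.
      have : IsProbabilityMeasure (HiddenGMRF.altLaw φ S) := by
        unfold HiddenGMRF.altLaw
        infer_instance
      rw [← hc, Nat.cast_one, div_one]
      exact measureReal_le_one
    · have hL : 0 < Real.log 𝒞.card := Real.log_pos (by exact_mod_cast hc)
      refine HiddenGMRF.altLaw_glrTest_le_of_l1Norm_le hη hφ h1 𝒞 hne hS hL (hint S hS) hp hk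
        (hK ▸ hM) hM1 (hN.trans ?_)
      exact mul_le_mul_of_nonneg_left (by exact_mod_cast Finset.inf'_le Finset.card hS)
        (sq_nonneg _)
  calc HiddenGMRF.risk 𝒞 hne φ (HiddenGMRF.glrTest 𝒞 hne φ)
      ≤ 1 / 𝒞.card + 1 / 𝒞.card := add_le_add hnull (Finset.sup'_le hne _ halt)
    _ = 2 / 𝒞.card := by ring
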